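/- Let $H,H',C$ be finitely generated abelian groups and $\langle-,-\rangle:H\times H'\to C$ a biadditive pairing. Let $G=H\times H'\times C$ be the discrete Heisenberg group with $(n,p,c)(m,q,a)=(n+m,\,p+q,\,c+a+\langle n,q\rangle)$. Let $r\in H$ and let $A\subset\mathrm{Hom}(H,H')$ be a subgroup such that $\langle m,k(m')\rangle=\langle m',k(m)\rangle$ and $\langle m-r,k(m)\rangle\in 2C$ for all $k\in A$, $m,m'\in H$. The halves $\tfrac12\langle m-r,k(m)\rangle\in C$ are unique if $C$ has no element of order $2$; in general they are supposed to be chosen so that $k(m,p,c)=(m,\,p+k(m),\,c+\tfrac12\langle m-r,k(m)\rangle)$ is an action of $A$ on $G$ by automorphisms. Let $\hat G=G\rtimes A$, with $k^{-1}gk=k(g)$ for $g\in G$, $k\in A$; write $(m,p,c,k)$ for $(m,p,c)\cdot k$. For a finitely generated abelian group $B$ put $\mathbb T_B=\mathrm{Hom}(B,\mathbb C^*)$, and let $\mathbb T_{\hat G}=\mathbb T_H\times\mathbb T_{H'}\times\mathbb T_C\times\mathbb T_A$. For $\hat\chi=(\chi_H,\chi_{H'},\chi_C,\chi_A)\in\mathbb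 T_{\hat G}$ let $H_\chi=\{h\in H:\chi_C(\langle h,p\rangle)=1\ \forall p\in H'\}$ and $G_\chi=H_\chi H'C$; $\chi=\chi_H\otimes\chi_{H'}\otimes\chi_C$ is a character of $G_\chi$. Let $V_\chi$ be the space of functions $f:G\to\mathbb C$ with $f(hg)=\chi(h)f(g)$ for $h\in G_\chi$ and with support in a finite union of cosets $G_\chi s$. Call $\hat\chi$ *extendable* if $\chi|_{G_\chi}$ is invariant under $A$, i.e. $\chi_{H'}(k(m))\,\chi_C(\tfrac12\langle m-r,k(m)\rangle)=1$ for all $m\in H_\chi$, $k\in A$. For extendable $\hat\chi$ let $\hat\pi_{\hat\chi}$ be the representation of $\hat G$ on $V_\chi$ given by $(\hat\pi_{\hat\chi}(g\cdot k)f)(x)=\chi_A(k)\,f(k(xg))$ for $g\in G$, $k\in A$. Let $F_g(\hat\chi)=\mathrm{Tr}\,\hat\pi_{\hat\chi}(g)$ be the (possibly infinite) matrix trace with respect to the basis of $V_\chi$ indexed by $n\in H/H_\chi$ that consists of the functions supported on the single coset $G_\chi(n,0,0)$ and equal to $1$ at a chosen representative $(n,0,0)$. Let $A(\chi)$ be the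 set of all $k\in A$ such that $|\chi_C(\langle n,k(n)\rangle)|<1$ for all $0\ne n\in H/H_\chi$ and the real quadratic form $n\mapsto-\log|\chi_C(\langle n,k(n)\rangle)|$ is positive definite on $(H/H_\chi)\otimes\mathbb R$. Put $\hat G(\chi)=G\times A(\chi)\subset\hat G$. For $k\in A$ let $T'(k)$ be the set of extendable $\hat\chi$ with $k\in A(\chi)$, and let $\mathcal M_G(k)$ be its quotient by the action of $\mathbb T_{H/H_\chi}\times H$, where $\mathbb T_{H/H_\chi}\subset\mathbb T_H$ is the group of characters of $H$ trivial on $H_\chi$: $$(t,h)(\chi_H,\chi_{H'},\chi_C,\chi_A)=(t\chi_H,\ h(\chi_{H'}),\ \chi_C,\ \chi_A'),\qquad h(\chi_{H'})(p)=\chi_{H'}(p)\chi_C(\langle h,p\rangle),$$ $$\chi_A'(l)=\chi_A(l)\,\chi_{H'}(l(h))\,\chi_C(\tfrac12\langle h-r,l(h)\rangle),\quad l\in A.$$ Here $T'(k)$ is regarded as the disjoint union of its strata on which the subgroup $H_\chi$ is constant, each stratum with the topology of a subset of $\mathbb T_{\hat G}$; a function on $T'(k)$ is holomorphic if locally, on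 each stratum, it is the restriction of a holomorphic function of the ambient torus; $\mathcal M_G(k)$ has the quotient topology, and a function on it is holomorphic near a point if its pullback to $T'(k)$ is holomorphic near all points above. Then: 1. For every extendable $\hat\chi$ and every $g\in\hat G(\chi)$ the trace $F_g(\hat\chi)$ exists (the sum of the diagonal matrix elements converges absolutely). 2. Let $\hat\chi,\hat\chi'$ be extendable with $A(\chi)\neq\emptyset$. The representations $\hat\pi_{\hat\chi}$ and $\hat\pi_{\hat\chi'}$ of $\hat G$ are equivalent if and only if $\hat G(\chi)=\hat G(\chi')$ and $F_g(\hat\chi)=F_g(\hat\chi')$ for all $g\in\hat G(\chi)$. 3. For every $k\in A$ the space $\mathcal M_G(k)$ with these holomorphic functions is a complex-analytic manifold (Hausdorff, second countable, locally isomorphic to open subsets of some $\mathbb C^d$, where $d$ may vary from one component to another). For every $g=(m,p,c,k)\in\hat G$ with this last component $k$, the trace $F_g$ defines a holomorphic function on $\mathcal M_G(k)$. The space $\mathcal M_G(k)$ is a moduli space for the representations $\hat\pi_{\hat\chi}$, $\hat\chi\in T'(k)$: two elements of $T'(k)$ define the same point of $\mathcal M_G(k)$ if and only if the corresponding representations are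 equivalent. -/

import Mathlib

open Topology

/-- The data of a discrete Heisenberg group extended by "loop rotations": a biadditive pairing
`H × H' → C`, a subgroup `A ⊆ Hom (H, H')`, an element `r ∈ H`, such that
`⟨m, k m'⟩ = ⟨m', k m⟩` and such that `⟨m - r, k m⟩` is divisible by two, with half
`half k m = 1/2 ⟨m - r, k m⟩`. If `C` has no element of order two then the half is unique and the
last two fields follow from the others; in general they say which halves have to be taken for
`(m, p, c) ↦ (m, p + k m, c + 1/2 ⟨m - r, k m⟩)` to be an action of `A` by group automorphisms. -/
structure ExtHeis (H H' C : Type*) [AddCommGroup H] [AddCommGroup H'] [AddCommGroup C] where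
  pairing : H →+ H' →+ C
  A : AddSubgroup (H →+ H')
  r : H
  symm : ∀ (k : A) (m m' : H), pairing m (k.1 m') = pairing m' (k.1 m)
  half : A → H → C
  two_half : ∀ (k : A) (m : H), half k m + half k m = pairing (m - r) (k.1 m)
  half_add : ∀ (k : A) (m m' : H),
    half k (m + m') = half k m + half k m' + pairing m (k.1 m')
  half_add_left : ∀ (k k' : A) (m : H), half (k + k') m = half k m + half k' m

namespace ExtHeis

variable {H H' C : Type*} [AddCommGroup H] [AddCommGroup H'] [AddCommGroup C]

/-! ### The groups -/

/-- The underlying set `H × H' × C` of the discrete Heisenberg group `G`. -/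
@[ext]
structure Heis (E : ExtHeis H H' C) where
  m : H
  p : H'
  c : C

variable (E : ExtHeis H H' C)

theorem half_zero (k : E.A) : E.half k 0 = 0 := by
  have h := E.half_add k 0 0
  simpa using h

theorem half_zero_left (m : H) : E.half 0 m = 0 := by
  have h := E.half_add_left 0 0 m
  simpa using h

theorem half_neg_left (k : E.A) (m : H) : E.half (-k) m = -E.half k m := by
  have h := E.half_add_left (-k) k m
  rw [neg_add_cancel, half_zero_left] at h
  exact eq_neg_of_add_eq_zero_left h.symm

instance : Mul E.Heis :=
  ⟨fun x y => ⟨x.m + y.m, x.p + y.p, x.c + y.c + E.pairing x.m y.p⟩⟩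

instance : One E.Heis := ⟨⟨0, 0, 0⟩⟩

instance : Inv E.Heis := ⟨fun x => ⟨-x.m, -x.p, -x.c + E.pairing x.m x.p⟩⟩

@[simp] theorem mul_m (x y : E.Heis) : (x * y).m = x.m + y.m := rfl
@[simp] theorem mul_p (x y : E.Heis) : (x * y).p = x.p + y.p := rfl
@[simp] theorem mul_c (x y : E.Heis) : (x * y).c = x.c + y.c + E.pairing x.m y.p := rfl
@[simp] theorem one_m : (1 : E.Heis).m = 0 := rfl
@[simp] theorem one_p : (1 : E.Heis).p = 0 := rfl
@[simp] theorem one_c : (1 : E.Heis).c = 0 := rfl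
@[simp] theorem inv_m (x : E.Heis) : (x⁻¹).m = -x.m := rfl
@[simp] theorem inv_p (x : E.Heis) : (x⁻¹).p = -x.p := rfl
@[simp] theorem inv_c (x : E.Heis) : (x⁻¹).c = -x.c + E.pairing x.m x.p := rfl

/-- The group law `(n, p, c) (m, q, a) = (n + m, p + q, c + a + ⟨n, q⟩)` of `G`. -/
instance : Group E.Heis :=
  Group.ofLeftAxioms
    (fun x y z => by
      ext
      · simp [add_assoc]
      · simp [add_assoc]
      · simp only [mul_c, mul_m, mul_p, map_add, AddMonoidHom.add_apply]; abel)
    (fun x => by ext <;> simp)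
    (fun x => by ext <;> simp)

/-- The automorphism `(m, p, c) ↦ (m, p + k m, c + 1/2 ⟨m - r, k m⟩)` of `G`, for `k ∈ A`. -/
def aut (k : E.A) : E.Heis ≃* E.Heis where
  toFun x := ⟨x.m, x.p + k.1 x.m, x.c + E.half k x.m⟩
  invFun x := ⟨x.m, x.p - k.1 x.m, x.c - E.half k x.m⟩
  left_inv x := by ext <;> simp
  right_inv x := by ext <;> simp
  map_mul' x y := by
    ext
    · simp
    · simp only [mul_p, mul_m, map_add]; abel
    · simp only [mul_m, mul_c, map_add, E.half_add]; abel

/-- `k ∈ A` acts on `G` by the inverse of `aut k`: in the semidirect product this makes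
conjugation `g ↦ k⁻¹ g k` the automorphism `aut k`. -/
def autHom : Multiplicative E.A →* MulAut E.Heis where
  toFun k := (E.aut k.toAdd).symm
  map_one' := by
    ext x
    · rfl
    · exact sub_zero x.p
    · change x.c - E.half 0 x.m = x.c
      rw [half_zero_left, sub_zero]
  map_mul' k l := by
    ext x
    · rfl
    · change x.p - (k.toAdd + l.toAdd).1 x.m = x.p - l.toAdd.1 x.m - k.toAdd.1 x.m
      simp only [AddSubgroup.coe_add, AddMonoidHom.add_apply]; abel
    · change x.c - E.half (k.toAdd + l.toAdd) x.m
        = x.c - E.half l.toAdd x.m - E.half k.toAdd x.m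
      rw [E.half_add_left]; abel

/-- The extended group `Ĝ = G ⋊ A`. -/
abbrev Ghat : Type _ := E.Heis ⋊[E.autHom] Multiplicative E.A

/-- The component in `A` of an element of `Ĝ`. -/
def rot (g : E.Ghat) : E.A := g.right.toAdd

/-! ### Characters -/

/-- The torus `T_Ĝ = Hom (H, ℂˣ) × Hom (H', ℂˣ) × Hom (C, ℂˣ) × Hom (A, ℂˣ)`. -/
@[ext]
structure Torus where
  chH : AddChar H ℂ
  chH' : AddChar H' ℂ
  chC : AddChar C ℂ
  chA : AddChar E.A ℂ

/-- The kernel `H_χ` of `H → Hom (H', ℂˣ)`, `h ↦ (p ↦ χ_C ⟨h, p⟩)`; it depends only on `χ_C`. -/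
def ker (ψ : AddChar C ℂ) : AddSubgroup H where
  carrier := {h | ∀ p : H', ψ (E.pairing h p) = 1}
  zero_mem' p := by simp
  add_mem' {a b} ha hb p := by
    have ha' := ha p
    have hb' := hb p
    simp [AddChar.map_add_eq_mul, ha', hb']
  neg_mem' {a} ha p := by
    have ha' := ha p
    simp [AddChar.map_neg_eq_inv, ha']

/-- The subgroup `G_χ = H_χ H' C` of `G`. -/
def subG (ψ : AddChar C ℂ) : Subgroup E.Heis where
  carrier := {x | x.m ∈ E.ker ψ}
  one_mem' := (E.ker ψ).zero_mem
  mul_mem' ha hb := (E.ker ψ).add_mem ha hb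
  inv_mem' ha := (E.ker ψ).neg_mem ha

/-- The function `χ = χ_H ⊗ χ_H' ⊗ χ_C` on `G`; it is a character on `G_χ`. -/
def chi (x : E.Torus) (g : E.Heis) : ℂ := x.chH g.m * x.chH' g.p * x.chC g.c

/-- The condition under which `π_χ` extends to `Ĝ` on the same space: the character
`χ` of `G_χ` is invariant under `A`, that is, `χ_H' (k m) χ_C (1/2 ⟨m - r, k m⟩) = 1` for all
`m ∈ H_χ`, `k ∈ A`. -/
def Extendable (x : E.Torus) : Prop :=
  ∀ k : E.A, ∀ m ∈ E.ker x.chC, x.chH' (k.1 m) * x.chC (E.half k m) = 1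

/-- The characters `χ̂ ∈ T_Ĝ` for which the representation `π̂_χ̂` is defined. -/
abbrev ExtChar : Type _ := {x : E.Torus // E.Extendable x}

theorem chi_aut (x : E.ExtChar) (k : E.A) {g : E.Heis} (hg : g ∈ E.subG x.1.chC) :
    E.chi x.1 (E.aut k g) = E.chi x.1 g := by
  have h := x.2 k g.m hg
  change x.1.chH g.m * x.1.chH' (g.p + k.1 g.m) * x.1.chC (g.c + E.half k g.m)
    = x.1.chH g.m * x.1.chH' g.p * x.1.chC g.c
  rw [AddChar.map_add_eq_mul, AddChar.map_add_eq_mul]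
  linear_combination (x.1.chH g.m * x.1.chH' g.p * x.1.chC g.c) * h

/-! ### The representations -/

/-- The space `V_χ` of all functions `f : G → ℂ` with `f (h g) = χ (h) f (g)` for `h ∈ G_χ` and
with support in a finite union of cosets `G_χ s`. -/
def V (x : E.Torus) : Submodule ℂ (E.Heis → ℂ) where
  carrier := {f | (∀ h ∈ E.subG x.chC, ∀ g, f (h * g) = E.chi x h * f g) ∧
    ∃ S : Finset E.Heis, ∀ g, f g ≠ 0 → ∃ s ∈ S, g * s⁻¹ ∈ E.subG x.chC}
  zero_mem' := ⟨fun _ _ _ => by simp, ∅, fun g hg => absurd rfl hg⟩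
  add_mem' := by
    classical
    rintro f f' ⟨h1, S, hS⟩ ⟨h1', S', hS'⟩
    refine ⟨fun h hh g => ?_, S ∪ S', fun g hg => ?_⟩
    · simp only [Pi.add_apply, h1 h hh g, h1' h hh g]; ring
    · by_cases h0 : f g = 0
      · have h0' : f' g ≠ 0 := fun h => hg (by simp [h0, h])
        obtain ⟨s, hs, h⟩ := hS' g h0'
        exact ⟨s, Finset.mem_union_right _ hs, h⟩
      · obtain ⟨s, hs, h⟩ := hS g h0
        exact ⟨s, Finset.mem_union_left _ hs, h⟩
  smul_mem' := by
    rintro a f ⟨h1, S, hS⟩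
    refine ⟨fun h hh g => ?_, S, fun g hg => hS g fun h => hg (by simp [h])⟩
    simp only [Pi.smul_apply, smul_eq_mul, h1 h hh g]; ring

theorem aut_mem (ψ : AddChar C ℂ) (k : E.A) (g : E.Heis) :
    E.aut k g ∈ E.subG ψ ↔ g ∈ E.subG ψ := Iff.rfl

theorem translate_mem (x : E.ExtChar) (g : E.Ghat) {f : E.Heis → ℂ} (hf : f ∈ E.V x.1) :
    (fun y => x.1.chA (E.rot g) * f (E.aut (E.rot g) (y * g.left))) ∈ E.V x.1 := by
  classical
  obtain ⟨h1, S, hS⟩ := hf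
  refine ⟨fun h hh y => ?_, S.image fun s => (E.aut (E.rot g)).symm s * g.left⁻¹,
    fun y hy => ?_⟩
  · have e : E.aut (E.rot g) (h * y * g.left)
        = E.aut (E.rot g) h * E.aut (E.rot g) (y * g.left) := by
      rw [mul_assoc, map_mul]
    simp only [e]
    rw [h1 _ ((E.aut_mem _ _ _).2 hh), E.chi_aut x _ hh]; ring
  · obtain ⟨s, hs, h⟩ := hS _ (right_ne_zero_of_mul hy)
    refine ⟨_, Finset.mem_image_of_mem _ hs, ?_⟩
    rw [← E.aut_mem _ (E.rot g)]
    simpa [mul_assoc] using h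

/-- The representation `π̂_χ̂ = π̂_χ ⊗ χ_A` of `Ĝ` on `V_χ`: an element `g ∈ G` acts by right
translation `f ↦ f (· g)`, an element `k ∈ A` by `f ↦ χ_A (k) f (k (·))`. -/
def rep (x : E.ExtChar) : Representation ℂ E.Ghat (E.V x.1) where
  toFun g :=
    { toFun := fun f =>
        ⟨fun y => x.1.chA (E.rot g) * f.1 (E.aut (E.rot g) (y * g.left)),
          E.translate_mem x g f.2⟩
      map_add' := fun f f' => by
        ext y
        simp [mul_add]
      map_smul' := fun a f => by
        ext y
        simp [mul_left_comm] }
  map_one' := by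
    ext f y
    have e : E.aut (E.rot 1) (y * (1 : E.Ghat).left) = y := by
      have : E.autHom 1 = 1 := map_one _
      have h2 : (E.aut 0).symm y = y := DFunLike.congr_fun this y
      change E.aut 0 (y * 1) = y
      rw [mul_one]
      exact ((E.aut 0).symm_apply_eq.1 h2).symm
    have e' : x.1.chA (E.rot 1) = 1 := AddChar.map_zero_eq_one _
    change x.1.chA (E.rot 1) * f.1 (E.aut (E.rot 1) (y * (1 : E.Ghat).left)) = f.1 y
    rw [e, e', one_mul]
  map_mul' g g' := by
    ext f y
    have e' : x.1.chA (E.rot (g * g')) = x.1.chA (E.rot g) * x.1.chA (E.rot g') :=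
      AddChar.map_add_eq_mul _ _ _
    have h3 : ∀ z, E.aut (E.rot (g * g')) z = E.aut (E.rot g') (E.aut (E.rot g) z) := by
      intro z
      ext
      · rfl
      · change z.p + (E.rot g + E.rot g').1 z.m = z.p + (E.rot g).1 z.m + (E.rot g').1 z.m
        simp [add_assoc]
      · change z.c + E.half (E.rot g + E.rot g') z.m
          = z.c + E.half (E.rot g) z.m + E.half (E.rot g') z.m
        rw [E.half_add_left]; abel
    have e : E.aut (E.rot (g * g')) (y * (g * g').left)
        = E.aut (E.rot g') (E.aut (E.rot g) (y * g.left) * g'.left) := by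
      have h4 : (g * g').left = g.left * (E.aut (E.rot g)).symm g'.left := rfl
      rw [h3, h4, ← mul_assoc, map_mul (E.aut (E.rot g)), MulEquiv.apply_symm_apply]
    change x.1.chA (E.rot (g * g')) * f.1 (E.aut (E.rot (g * g')) (y * (g * g').left))
      = x.1.chA (E.rot g) * (x.1.chA (E.rot g') *
          f.1 (E.aut (E.rot g') (E.aut (E.rot g) (y * g.left) * g'.left)))
    rw [e, e', mul_assoc]

/-- Equivalence of the representations `π̂_χ̂` and `π̂_χ̂'` of `Ĝ`. -/
def Equivalent (x y : E.ExtChar) : Prop := Nonempty ((E.rep x).Equiv (E.rep y))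

/-! ### The trace -/

/-- A representative in `G` of the coset of `G_χ` that belongs to `n ∈ H / H_χ`. -/
noncomputable def base (ψ : AddChar C ℂ) (n : H ⧸ E.ker ψ) : E.Heis := ⟨n.out, 0, 0⟩

open Classical in
/-- The basis of `V_χ` indexed by `H / H_χ`: the function with support `G_χ s` and value `1` at `s`,
where `s` is the chosen representative. -/
noncomputable def basisFun (x : E.Torus) (n : H ⧸ E.ker x.chC) : E.V x :=
  ⟨fun g => if g * (E.base x.chC n)⁻¹ ∈ E.subG x.chC then
      E.chi x (g * (E.base x.chC n)⁻¹) else 0, by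
    refine ⟨fun h hh g => ?_, {E.base x.chC n}, fun g hg => ?_⟩
    · simp only [mul_assoc, Subgroup.mul_mem_cancel_left _ hh]
      split_ifs with h1
      · have h2 : x.chC (E.pairing h.m (g * (E.base x.chC n)⁻¹).p) = 1 := hh _
        simp only [chi, mul_m, mul_p, mul_c] at h2 ⊢
        simp only [AddChar.map_add_eq_mul, h2]
        ring
      · simp
    · refine ⟨_, Finset.mem_singleton_self _, ?_⟩
      by_contra h
      exact hg (if_neg h)⟩

/-- The diagonal matrix element of the operator `π̂_χ̂ (g)` at the basis vector with index `n`. (The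
coefficient of `f ∈ V_χ` at that basis vector is the value of `f` at the representative.) -/
noncomputable def diagCoeff (x : E.ExtChar) (g : E.Ghat) (n : H ⧸ E.ker x.1.chC) : ℂ :=
  (E.rep x g (E.basisFun x.1 n)).1 (E.base x.1.chC n)

/-- The trace of `π̂_χ̂ (g)` exists. -/
def TraceExists (x : E.ExtChar) (g : E.Ghat) : Prop := Summable (E.diagCoeff x g)

/-- The character `F_g (χ̂) = Tr π̂_χ̂ (g)`. -/
noncomputable def F (g : E.Ghat) (x : E.ExtChar) : ℂ := ∑' n, E.diagCoeff x g n

/-- The set `A (χ)`, which depends only on `χ_C`: the `k ∈ A` with `|χ_C ⟨n, k n⟩| < 1` for all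
`n ≠ 0` in `H / H_χ`, such that moreover the quadratic form `n ↦ - log |χ_C ⟨n, k n⟩|` is positive
definite over the real numbers (all Gram matrices of linearly independent families in `H / H_χ` are
positive definite). -/
def Apos (ψ : AddChar C ℂ) : Set E.A :=
  {k | (∀ n : H, n ∉ E.ker ψ → ‖ψ (E.pairing n (k.1 n))‖ < 1) ∧
    ∀ (d : ℕ) (e : Fin d → H), LinearIndependent ℤ (fun i => (e i : H ⧸ E.ker ψ)) →
      (Matrix.of fun i j => -Real.log ‖ψ (E.pairing (e i) (k.1 (e j)))‖).PosDef}

/-- The subset `Ĝ (χ) = G × A (χ)` of `Ĝ`. -/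
def GhatPos (x : E.ExtChar) : Set E.Ghat := {g | E.rot g ∈ E.Apos x.1.chC}

/-! ### The space `M_G (k)` -/

/-- The action `(t, h) (χ_H, χ_H', χ_C, χ_A) = (t χ_H, h (χ_H'), χ_C, χ_A')` with
`h (χ_H') (p) = χ_H' (p) χ_C ⟨h, p⟩`, `χ_A' (k) = χ_A (k) χ_H' (k h) χ_C (1/2 ⟨h - r, k h⟩)`. -/
def act (t : AddChar H ℂ) (h : H) (x : E.Torus) : E.Torus where
  chH := t * x.chH
  chH' :=
    { toFun := fun p => x.chH' p * x.chC (E.pairing h p)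
      map_zero_eq_one' := by simp
      map_add_eq_mul' := fun p q => by
        simp only [map_add, AddChar.map_add_eq_mul]; ring }
  chC := x.chC
  chA :=
    { toFun := fun k => x.chA k * x.chH' (k.1 h) * x.chC (E.half k h)
      map_zero_eq_one' := by simp [half_zero_left]
      map_add_eq_mul' := fun k l => by
        simp only [E.half_add_left, AddSubgroup.coe_add, AddMonoidHom.add_apply,
          AddChar.map_add_eq_mul]
        ring }

theorem act_act (t t' : AddChar H ℂ) (h h' : H) (x : E.Torus) :
    E.act t h (E.act t' h' x) = E.act (t * t') (h + h') x := by
  ext a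
  · simp [act, mul_assoc]
  · simp only [act, AddChar.coe_mk, map_add, AddMonoidHom.add_apply, AddChar.map_add_eq_mul]
    ring
  · rfl
  · have e : E.pairing h' (a.1 h) = E.pairing h (a.1 h') := E.symm a h' h
    simp only [act, AddChar.coe_mk, map_add, AddMonoidHom.add_apply, AddChar.map_add_eq_mul,
      E.half_add, e]
    ring

theorem act_one_zero (x : E.Torus) : E.act 1 0 x = x := by
  ext a
  · simp [act]
  · simp [act]
  · rfl
  · simp [act, half_zero]

/-- The domain on which `M_G (k)` lives: the `χ̂ ∈ T_Ĝ` with `k ∈ A (χ)` for which `π̂_χ̂` is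
defined. -/
def Dom (k : E.A) : Type _ := {x : E.ExtChar // k ∈ E.Apos x.1.chC}

/-- The orbit relation of the action of the groups `T_{H / H_χ} × H`, where `T_{H / H_χ}` is the
group of all `t ∈ T_H` that are trivial on `H_χ`. -/
def orbitSetoid (k : E.A) : Setoid (E.Dom k) where
  r x y := ∃ (t : AddChar H ℂ) (h : H), (∀ m ∈ E.ker x.1.1.chC, t m = 1) ∧
    y.1.1 = E.act t h x.1.1
  iseqv :=
    { refl := fun x => ⟨1, 0, fun _ _ => rfl, (E.act_one_zero _).symm⟩
      symm := by
        rintro x y ⟨t, h, ht, e⟩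
        have ec : y.1.1.chC = x.1.1.chC := by rw [e]; rfl
        refine ⟨t⁻¹, -h, fun m hm => ?_, ?_⟩
        · rw [ec] at hm
          have := ht _ ((E.ker x.1.1.chC).neg_mem hm)
          simpa [AddChar.inv_apply] using this
        · rw [e, act_act, inv_mul_cancel, neg_add_cancel, act_one_zero]
      trans := by
        rintro x y z ⟨t, h, ht, e⟩ ⟨t', h', ht', e'⟩
        have ec : y.1.1.chC = x.1.1.chC := by rw [e]; rfl
        refine ⟨t' * t, h' + h, fun m hm => ?_, ?_⟩
        · rw [AddChar.mul_apply, ht m hm, ht' m (by rw [ec]; exact hm), one_mul]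
        · rw [e', e, act_act] }

/-- The quotient `M_G (k)`. -/
def Moduli (k : E.A) : Type _ := Quotient (E.orbitSetoid k)

/-- The quotient map onto `M_G (k)`. -/
def Moduli.mk {E : ExtHeis H H' C} {k : E.A} (x : E.Dom k) : E.Moduli k :=
  Quotient.mk (E.orbitSetoid k) x

/-- `T_Ĝ` as the torus of characters of `H × H' × C × A`. -/
def ev (x : E.Torus) (γ : H × H' × C × E.A) : ℂ :=
  x.chH γ.1 * x.chH' γ.2.1 * x.chC γ.2.2.1 * x.chA γ.2.2.2

/-- The topology of the domain: that of a subset of the torus `T_Ĝ` (pointwise convergence of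
characters) on every stratum on which the subgroup `H_χ`, and hence the group that acts, is
constant; the domain is the disjoint union of these strata. -/
noncomputable instance (k : E.A) : TopologicalSpace (E.Dom k) :=
  TopologicalSpace.induced (fun x : E.Dom k => E.ev x.1.1) inferInstance ⊓
    TopologicalSpace.induced (fun x : E.Dom k => E.ker x.1.1.chC) ⊥

/-- `M_G (k)` has the quotient topology. -/
noncomputable instance (k : E.A) : TopologicalSpace (E.Moduli k) :=
  inferInstanceAs (TopologicalSpace (Quotient (E.orbitSetoid k)))

/-- Holomorphy of a function on the domain near the point `x`: there it is a holomorphic function of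
the values of finitely many of the coordinates `χ̂ ↦ χ̂ (γ)` of the torus. -/
def DomHolAt {k : E.A} (f : E.Dom k → ℂ) (x : E.Dom k) : Prop :=
  ∃ (N : ℕ) (γ : Fin N → H × H' × C × E.A) (Φ : (Fin N → ℂ) → ℂ),
    (∀ᶠ z in 𝓝 (fun i => E.ev x.1.1 (γ i)), DifferentiableAt ℂ Φ z) ∧
    ∀ᶠ y in 𝓝 x, f y = Φ fun i => E.ev y.1.1 (γ i)

/-- Holomorphy of a function on the quotient `M_G (k)` near a point: its pullback to the domain is
holomorphic near all points above. -/
def ModuliHolAt {k : E.A} (f : E.Moduli k → ℂ) (q : E.Moduli k) : Prop :=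
  ∀ x : E.Dom k, Moduli.mk x = q → E.DomHolAt (fun y => f (Moduli.mk y)) x

end ExtHeis

/-- A Hausdorff second countable space with a notion `hol f x` of "the function `f` is holomorphic
near `x`" is a complex-analytic manifold if it is locally isomorphic to open subsets of `ℂ ^ d` with
their holomorphic functions. -/
structure IsComplexManifold (X : Type*) [TopologicalSpace X] (hol : (X → ℂ) → X → Prop) :
    Prop where
  t2 : T2Space X
  secondCountable : SecondCountableTopology X
  chart : ∀ x : X, ∃ (d : ℕ) (e : OpenPartialHomeomorph X (Fin d → ℂ)), x ∈ e.source ∧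
    ∀ y ∈ e.source, ∀ f : X → ℂ,
      hol f y ↔ ∀ᶠ z in 𝓝 (e y), DifferentiableAt ℂ (fun w => f (e.symm w)) z

/-! An element (m, p, c, k) with m ∈ H_χ maps every coset of G_χ to itself and multiplies the value
at (n, 0, 0) by χ̂ evaluated at the lattice element `shift n (m, p, c, k)`. All other elements move
every coset and have trace zero. The logarithm of the modulus of that factor is a constant plus a
linear form in n minus q(n)/2, where q(n) = −log |χ_C⟨n, k n⟩|. Positivity of q makes H/H_χ
torsion-free, hence free, so the trace is a theta series over a lattice, convergent locally
uniformly (`exists_summable_bound`).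

Two representations are equivalent exactly when their parameters lie in one orbit
(`equivalent_iff`): left translation by (h, 0, 0) intertwines, and conversely the joint eigenvalues
of the vector supported on G_χ can be read off in the other representation.

Traces determine the orbit (`exists_rel_of_F_eq`): at (a, j k), j ≥ 1, the trace is a sum of χ_n(a)
v_n^j over n. Linear independence of characters, together with the asymptotics of power sums,
recovers the pairs (χ_n, v_n), so one n carries χ̂ to χ̂' on H_χ × H' × C and on k. The set A(χ)
absorbs A, which extends the match to all of A.

For the manifold structure, a stratum is locally an open piece of a translate of a subtorus, because
positive definiteness is an open condition; monomials are local coordinates (`exists_section`). The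
factor T_{H/H_χ} is removed by a slice on which χ_H is trivial on a complement of H_χ
(`exists_slice`). What remains is H/H_χ, which acts freely and properly discontinuously: it
translates the vector −log |χ_H'(k e_i)| by a positive definite matrix (`exists_finset_rel`,
`not_rel_self`). -/

/-! ### Quadratic forms, Gaussian sums, holomorphic series and power sums of characters -/

section Analysis

open Filter

/-- A positive definite quadratic form is bounded below, uniformly for all nearby forms. -/
theorem Matrix.PosDef.exists_forall_mul_sum_sq_le {d : ℕ} {M : Matrix (Fin d) (Fin d) ℝ}
    (hM : M.PosDef) : ∃ c > 0, ∀ M' : Matrix (Fin d) (Fin d) ℝ,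
      (∀ i j, |M' i j - M i j| ≤ c) →
        ∀ v : Fin d → ℝ, c * ∑ i, v i ^ 2 ≤ ∑ i, ∑ j, v i * v j * M' i j := by
  have hpos : ∀ v : Fin d → ℝ, v ≠ 0 → 0 < ∑ i, ∑ j, v i * v j * M i j := by
    intro v hv
    have := (Matrix.posDef_iff_dotProduct_mulVec.1 hM).2 hv
    simpa [dotProduct, Matrix.mulVec, Finset.mul_sum, mul_assoc, mul_left_comm, mul_comm] using this
  obtain ⟨a, ha, hlow⟩ : ∃ a > 0, ∀ v : Fin d → ℝ, ‖v‖ = 1 →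
      a ≤ ∑ i, ∑ j, v i * v j * M i j := by
    rcases (Metric.sphere (0 : Fin d → ℝ) 1).eq_empty_or_nonempty with h | h
    -- The sphere is empty when d = 0; any positive constant serves.
    · refine ⟨1, one_pos, fun v hv => ?_⟩
      have : v ∈ Metric.sphere (0 : Fin d → ℝ) 1 := by simpa using hv
      simp [h] at this
    · obtain ⟨v, hv, hmin⟩ := (isCompact_sphere (0 : Fin d → ℝ) 1).exists_isMinOn h
        (f := fun v : Fin d → ℝ => ∑ i, ∑ j, v i * v j * M i j) (by fun_prop)
      refine ⟨_, hpos v (fun h0 => by simp [h0] at hv), fun w hw => ?_⟩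
      exact hmin (by simpa using hw)
  have hlow' : ∀ v : Fin d → ℝ, a * ‖v‖ ^ 2 ≤ ∑ i, ∑ j, v i * v j * M i j := by
    intro v
    by_cases hv : v = 0
    · simp [hv]
    have hn : ‖v‖ ≠ 0 := norm_ne_zero_iff.2 hv
    have := hlow (‖v‖⁻¹ • v) (by rw [norm_smul, norm_inv, norm_norm, inv_mul_cancel₀ hn])
    have e : ∑ i, ∑ j, (‖v‖⁻¹ • v) i * (‖v‖⁻¹ • v) j * M i j
        = (‖v‖ ^ 2)⁻¹ * ∑ i, ∑ j, v i * v j * M i j := by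
      simp only [Finset.mul_sum, Pi.smul_apply, smul_eq_mul]
      refine Finset.sum_congr rfl fun i _ => Finset.sum_congr rfl fun j _ => ?_
      field_simp
    rw [e, inv_mul_eq_div, le_div_iff₀ (by positivity)] at this
    exact this
  have hD : (0 : ℝ) < (d : ℝ) ^ 2 + d + 1 := by positivity
  -- Perturbing the entries by at most c costs d² c ‖v‖², and c ∑ v_i² ≤ d c ‖v‖²; both fit into a
  -- ‖v‖² = (d² + d + 1) c ‖v‖².
  refine ⟨a / ((d : ℝ) ^ 2 + d + 1), by positivity, fun M' hM' v => ?_⟩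
  set c := a / ((d : ℝ) ^ 2 + d + 1) with hc
  have hc0 : 0 < c := by positivity
  have hac : a = c * ((d : ℝ) ^ 2 + d + 1) := by rw [hc]; field_simp
  have h1 : ∑ i, v i ^ 2 ≤ d * ‖v‖ ^ 2 := by
    have : ∀ i ∈ Finset.univ, v i ^ 2 ≤ ‖v‖ ^ 2 := fun i _ => by
      rw [← sq_abs]
      exact pow_le_pow_left₀ (abs_nonneg _) (norm_le_pi_norm v i) 2
    simpa using Finset.sum_le_sum this
  have h2 : ∑ i, ∑ j, v i * v j * M i j - ∑ i, ∑ j, v i * v j * M' i j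
      ≤ (d : ℝ) ^ 2 * (c * ‖v‖ ^ 2) := by
    have : ∀ i ∈ Finset.univ, ∀ j ∈ Finset.univ,
        v i * v j * M i j - v i * v j * M' i j ≤ c * ‖v‖ ^ 2 := fun i _ j _ => by
      rw [← mul_sub]
      refine (le_abs_self _).trans ?_
      rw [abs_mul, abs_mul, abs_sub_comm]
      have hi : |v i| ≤ ‖v‖ := norm_le_pi_norm v i
      have hj : |v j| ≤ ‖v‖ := norm_le_pi_norm v j
      calc |v i| * |v j| * |M' i j - M i j| ≤ ‖v‖ * ‖v‖ * c := by
            gcongr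
            exact hM' i j
        _ = c * ‖v‖ ^ 2 := by ring
    have h := Finset.sum_le_sum fun i hi => Finset.sum_le_sum (this i hi)
    simp only [Finset.sum_sub_distrib, Finset.sum_const, Finset.card_univ, Fintype.card_fin,
      nsmul_eq_mul] at h
    nlinarith
  have h3 := hlow' v
  nlinarith [mul_le_mul_of_nonneg_left h1 hc0.le, mul_nonneg hc0.le (sq_nonneg ‖v‖)]

theorem Summable.prod_pi {α : Type*} {f : α → ℝ} (hf : Summable f) (h0 : ∀ a, 0 ≤ f a) (d : ℕ) :
    Summable fun n : Fin d → α => ∏ i, f (n i) := by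
  induction d with
  | zero => exact Summable.of_finite
  | succ d ih =>
    rw [← (Fin.consEquiv fun _ => α).summable_iff]
    have := hf.mul_of_nonneg ih h0 fun n => Finset.prod_nonneg fun i _ => h0 _
    refine this.congr fun x => ?_
    simp [Fin.consEquiv, Fin.prod_univ_succ]

theorem Real.summable_exp_neg_sq_add_abs {c : ℝ} (hc : 0 < c) (b : ℝ) :
    Summable fun n : ℤ => Real.exp (-c * (n : ℝ) ^ 2 + b * |(n : ℝ)|) := by
  have key : Summable fun n : ℤ => Real.exp (-|(n : ℝ)|) := by
    refine summable_int_iff_summable_nat_and_neg.2 ⟨?_, ?_⟩ <;>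
      simpa using! Real.summable_exp_neg_nat
  -- (b + 1)² / (4c) is the maximum of −c t² + (b + 1) t, so each term is at most a constant times
  -- exp(−|n|).
  refine Summable.of_nonneg_of_le (fun _ => (Real.exp_pos _).le) (fun n => ?_)
    (key.mul_left (Real.exp ((b + 1) ^ 2 / (4 * c))))
  rw [← Real.exp_add]
  refine Real.exp_le_exp.2 ?_
  have h := sq_nonneg (2 * c * |(n : ℝ)| - (b + 1))
  have h2 : (b + 1) ^ 2 / (4 * c) * (4 * c) = (b + 1) ^ 2 := by field_simp
  rw [← sq_abs (n : ℝ)]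
  by_contra! hcon
  have := mul_lt_mul_of_pos_right hcon (mul_pos four_pos hc)
  nlinarith

theorem Real.summable_exp_neg_sum_sq_add_abs {c : ℝ} (hc : 0 < c) (b : ℝ) (d : ℕ) :
    Summable fun n : Fin d → ℤ =>
      Real.exp (-c * ∑ i, (n i : ℝ) ^ 2 + b * ∑ i, |(n i : ℝ)|) := by
  refine ((Real.summable_exp_neg_sq_add_abs hc b).prod_pi (fun _ => (Real.exp_pos _).le) d).congr
    fun n => ?_
  rw [← Real.exp_sum, Finset.sum_add_distrib, Finset.mul_sum, Finset.mul_sum]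

/-- Weierstrass: a series of holomorphic functions of several variables with a summable bound is
holomorphic. -/
theorem eventually_differentiableAt_tsum {ι E : Type*} [NormedAddCommGroup E] [NormedSpace ℂ E]
    {f : ι → E → ℂ} {u : ι → ℝ} (hu : Summable u) {z₀ : E}
    (h : ∀ᶠ z in 𝓝 z₀, ∀ i, DifferentiableAt ℂ (f i) z ∧ ‖f i z‖ ≤ u i) :
    ∀ᶠ z in 𝓝 z₀, DifferentiableAt ℂ (fun z => ∑' i, f i z) z := by
  obtain ⟨R, hR, hball⟩ := Metric.eventually_nhds_iff_ball.1 h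
  have hsub : ∀ z ∈ Metric.ball z₀ (R / 2), Metric.ball z (R / 2) ⊆ Metric.ball z₀ R :=
    fun z hz => Metric.ball_subset_ball' (by rw [Metric.mem_ball] at hz; linarith)
  filter_upwards [Metric.ball_mem_nhds z₀ (half_pos hR)] with z hz
  -- Cauchy's estimate on balls of radius R/2: there f i stays within u i + u i of its value at the
  -- centre.
  refine (hasFDerivAt_tsum_of_isPreconnected (𝕜 := ℂ) (u := fun i => (u i + u i) / (R / 2))
    (f' := fun i z => fderiv ℂ (f i) z) ((hu.add hu).div_const _) Metric.isOpen_ball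
    (convex_ball z₀ (R / 2)).isPreconnected (fun i y hy => ?_) (fun i y hy => ?_)
    (Metric.mem_ball_self (half_pos hR)) ?_ hz).differentiableAt
  · exact (hball y (Metric.ball_subset_ball (by linarith) hy) i).1.hasFDerivAt
  · refine Complex.norm_fderiv_le_div_of_mapsTo_ball
      (fun w hw => (hball w (hsub y hy hw) i).1.differentiableWithinAt) (fun w hw => ?_)
      (half_pos hR)
    rw [Metric.mem_closedBall, dist_eq_norm]
    exact (norm_sub_le _ _).trans (add_le_add (hball w (hsub y hy hw) i).2
      (hball y (hsub y hy (Metric.mem_ball_self (half_pos hR))) i).2)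
  · exact Summable.of_norm_bounded hu fun i => (hball z₀ (Metric.mem_ball_self hR) i).2

/-- The polynomial P vanishes at the finitely many values of modulus at least ‖v‖ other than v. The
sum of a_i P(U_i) (U_i / v)^(j+1) is a combination of vanishing power sums; as j → ∞ the terms with
smaller modulus die and P(v) times the sum over the fibre of v remains. -/
theorem sum_fiber_eq_zero_of_tsum_mul_pow_eq_zero {α : Type*} {a U : α → ℂ}
    (hs : ∀ j ≥ 1, Summable fun i => a i * U i ^ j) (h0 : ∀ j ≥ 1, ∑' i, a i * U i ^ j = 0)
    {v : ℂ} (hv : v ≠ 0) (hfin : {i | ‖v‖ ≤ ‖U i‖}.Finite) :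
    ∑ i ∈ hfin.toFinset with U i = v, a i = 0 := by
  classical
  set P : Polynomial ℂ := ∏ w ∈ (hfin.toFinset.image U).erase v, (Polynomial.X - Polynomial.C w)
  have hP : ∀ i, ‖v‖ ≤ ‖U i‖ → U i ≠ v → P.eval (U i) = 0 := by
    intro i hi hne
    rw [Polynomial.eval_prod]
    refine Finset.prod_eq_zero (i := U i) ?_ (by simp)
    exact Finset.mem_erase.2 ⟨hne, Finset.mem_image_of_mem _ (by simpa using hi)⟩
  have hPv : P.eval v ≠ 0 := by
    rw [Polynomial.eval_prod]
    refine Finset.prod_ne_zero_iff.2 fun w hw => ?_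
    simpa [sub_eq_zero] using (Finset.ne_of_mem_erase hw).symm
  -- The exponent j + 1 keeps every power at least 1; the series with exponent 0 need not converge.
  have expand : ∀ j i, a i * P.eval (U i) * (U i / v) ^ (j + 1)
      = ∑ k ∈ Finset.range (P.natDegree + 1),
        (P.coeff k * (v ^ (j + 1))⁻¹) * (a i * U i ^ (j + 1 + k)) := by
    intro j i
    rw [Polynomial.eval_eq_sum_range, Finset.mul_sum, Finset.sum_mul]
    refine Finset.sum_congr rfl fun k _ => ?_
    rw [div_pow, pow_add]
    field_simp
    ring
  have hsum : ∀ j, Summable fun i => a i * P.eval (U i) * (U i / v) ^ (j + 1) := by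
    intro j
    simp only [expand]
    exact summable_sum fun k _ => (hs _ (by omega)).mul_left _
  have hzero : ∀ j, ∑' i, a i * P.eval (U i) * (U i / v) ^ (j + 1) = 0 := by
    intro j
    simp only [expand]
    rw [Summable.tsum_finsetSum fun k _ => (hs _ (by omega)).mul_left _]
    refine Finset.sum_eq_zero fun k _ => ?_
    rw [tsum_mul_left, h0 _ (by omega), mul_zero]
  have hlim := tendsto_tsum_of_dominated_convergence (𝓕 := atTop)
    (f := fun (j : ℕ) i => a i * P.eval (U i) * (U i / v) ^ (j + 1))
    (g := fun i => if U i = v then a i * P.eval v else 0) (hsum 0).norm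
    (fun i => by
      by_cases h1 : U i = v
      · simp [h1, hv]
      · simp only [h1, if_false]
        by_cases h2 : ‖v‖ ≤ ‖U i‖
        · simp [hP i h2 h1]
        · have : ‖U i / v‖ < 1 := by
            rw [norm_div, div_lt_one (norm_pos_iff.2 hv)]
            exact not_le.1 h2
          simpa using! ((tendsto_pow_atTop_nhds_zero_of_norm_lt_one this).comp
            (tendsto_add_atTop_nat 1)).const_mul (a i * P.eval (U i)))
    (Eventually.of_forall fun j i => by
      by_cases h1 : U i = v
      · simp [h1, hv]
      · by_cases h2 : ‖v‖ ≤ ‖U i‖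
        · simp [hP i h2 h1]
        · have : ‖U i / v‖ ≤ 1 := by
            rw [norm_div, div_le_one (norm_pos_iff.2 hv)]
            exact (not_le.1 h2).le
          rw [norm_mul, norm_mul (a i * P.eval (U i)), norm_pow, norm_pow]
          exact mul_le_mul_of_nonneg_left
            (pow_le_pow_of_le_one (norm_nonneg _) this (by omega)) (norm_nonneg _))
  simp only [hzero] at hlim
  have h3 := tendsto_nhds_unique hlim tendsto_const_nhds
  rw [tsum_eq_sum (s := hfin.toFinset.filter (U · = v)) (fun i hi => by
    refine if_neg fun h => hi ?_
    simp [h])] at h3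
  have h4 : (∑ i ∈ hfin.toFinset with U i = v, a i) * P.eval v = 0 := by
    rw [Finset.sum_mul, ← h3]
    exact Finset.sum_congr rfl fun i hi => by rw [if_pos (Finset.mem_filter.1 hi).2]
  exact (mul_eq_zero.1 h4).resolve_right hPv

theorem AddChar.linearIndependent_complex (M : Type*) [AddMonoid M] :
    LinearIndependent ℂ (fun χ : AddChar M ℂ => (χ : M → ℂ)) := by
  have := (linearIndependent_monoidHom (Multiplicative M) ℂ).comp
    (fun χ : AddChar M ℂ => χ.toMonoidHom) (fun χ χ' h => by
      ext m
      exact DFunLike.congr_fun h (Multiplicative.ofAdd m))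
  exact this

/-- The summands `(χ, v)` of a series `(m, j) ↦ ∑ χ (m) v ^ j`, `j ≥ 1`, are determined by its
sum. -/
theorem exists_eq_of_tsum_addChar_mul_pow_eq {M ι κ : Type*} [AddMonoid M]
    {χ : ι → AddChar M ℂ} {v : ι → ℂ} {χ' : κ → AddChar M ℂ} {v' : κ → ℂ}
    (hs : ∀ m, ∀ j ≥ 1, Summable fun i => χ i m * v i ^ j)
    (hs' : ∀ m, ∀ j ≥ 1, Summable fun i => χ' i m * v' i ^ j)
    (h : ∀ m, ∀ j ≥ 1, ∑' i, χ i m * v i ^ j = ∑' i, χ' i m * v' i ^ j)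
    (i' : κ) (hi' : v' i' ≠ 0) : ∃ i, χ i = χ' i' ∧ v i = v' i' := by
  classical
  by_contra! hcon
  -- Both series are joined into one with signs 1 and −1, whose sum is zero.
  let L : ι ⊕ κ → AddChar M ℂ := Sum.elim χ χ'
  let U : ι ⊕ κ → ℂ := Sum.elim v v'
  let c : ι ⊕ κ → ℂ := Sum.elim (fun _ => 1) (fun _ => -1)
  have hsL : ∀ m, ∀ j ≥ 1, HasSum (fun i => c i * L i m * U i ^ j) 0 := by
    intro m j hj
    have h1 := (hs m j hj).hasSum
    have h2 := (hs' m j hj).hasSum.neg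
    rw [h m j hj] at h1
    have := HasSum.sum (f := fun i => c i * L i m * U i ^ j)
      (by simpa [c, L, U, Function.comp_def] using h1)
      (by simpa [c, L, U, Function.comp_def] using h2)
    simpa using this
  have hfin : {i | ‖v' i'‖ ≤ ‖U i‖}.Finite := by
    have h1 := (hsL 0 1 le_rfl).summable.norm
    have h2 : Summable fun i => ‖U i‖ := h1.congr fun i => by
      rcases i with i | i <;> simp [c, L, U]
    have h3 := h2.tendsto_cofinite_zero.eventually (gt_mem_nhds (norm_pos_iff.2 hi'))
    refine (Filter.eventually_cofinite.1 h3).subset fun i hi => ?_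
    simpa using hi
  set S := hfin.toFinset.filter (U · = v' i') with hS
  have h1 : ∀ m, ∑ i ∈ S, c i * L i m = 0 := fun m =>
    sum_fiber_eq_zero_of_tsum_mul_pow_eq_zero (fun j hj => (hsL m j hj).summable)
      (fun j hj => (hsL m j hj).tsum_eq) hi' hfin
  have h2 : ∑ ψ ∈ S.image L, (∑ i ∈ S with L i = ψ, c i) • (ψ : M → ℂ) = 0 := by
    ext m
    rw [Finset.sum_apply, Pi.zero_apply, ← h1 m,
      ← Finset.sum_fiberwise_of_maps_to (fun i hi => Finset.mem_image_of_mem L hi)]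
    refine Finset.sum_congr rfl fun ψ _ => ?_
    rw [Pi.smul_apply, smul_eq_mul, Finset.sum_mul]
    exact Finset.sum_congr rfl fun i hi => by rw [(Finset.mem_filter.1 hi).2]
  have hmem : Sum.inr i' ∈ S := by simp [hS, U]
  have h3 := linearIndependent_iff'.1 (AddChar.linearIndependent_complex M) _ _ h2 (χ' i')
    (Finset.mem_image_of_mem L hmem)
  -- With no partner in the first family, all coefficients at this character and value are −1, so
  -- they cannot cancel.
  have h4 : ∑ i ∈ S with L i = χ' i', c i = ∑ i ∈ S with L i = χ' i', (-1 : ℂ) := by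
    refine Finset.sum_congr rfl fun i hi => ?_
    rcases i with i | i
    · simp only [hS, Finset.mem_filter] at hi
      exact absurd hi.1.2 (hcon i hi.2)
    · rfl
  rw [h4, Finset.sum_const, smul_neg, neg_eq_zero, nsmul_one, Nat.cast_eq_zero,
    Finset.card_eq_zero] at h3
  exact Finset.eq_empty_iff_forall_notMem.1 h3 (Sum.inr i') (Finset.mem_filter.2 ⟨hmem, rfl⟩)

end Analysis

/-! ### Finitely generated abelian groups and their characters -/

section Lattices

/-- A finitely generated abelian group modulo a subgroup and torsion is free: coordinates. -/
theorem AddSubgroup.exists_coordinates {Γ : Type*} [AddCommGroup Γ] [Module.Finite ℤ Γ]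
    (R : AddSubgroup Γ) : ∃ (d : ℕ) (γ : Fin d → Γ) (n : Fin d → Γ →+ ℤ),
      (∀ i j, n i (γ j) = if i = j then 1 else 0) ∧
      ∀ g, (∀ i, n i g = 0) ↔ ∃ N : ℤ, N ≠ 0 ∧ N • g ∈ R := by
  let B := Γ ⧸ R.toIntSubmodule
  let F := B ⧸ Submodule.torsion ℤ B
  let f : Γ →ₗ[ℤ] F := (Submodule.torsion ℤ B).mkQ ∘ₗ R.toIntSubmodule.mkQ
  have hf : Function.Surjective f :=
    (Submodule.mkQ_surjective _).comp (Submodule.mkQ_surjective _)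
  have hker : ∀ g, f g = 0 ↔ ∃ N : ℤ, N ≠ 0 ∧ N • g ∈ R := by
    intro g
    change (Submodule.torsion ℤ B).mkQ (R.toIntSubmodule.mkQ g) = 0 ↔ _
    rw [Submodule.mkQ_apply, Submodule.Quotient.mk_eq_zero, Submodule.mem_torsion_iff]
    constructor
    · rintro ⟨a, ha⟩
      refine ⟨a, nonZeroDivisors.ne_zero a.2, ?_⟩
      have : R.toIntSubmodule.mkQ ((a : ℤ) • g) = 0 := by rw [map_smul]; exact ha
      rwa [Submodule.mkQ_apply, Submodule.Quotient.mk_eq_zero] at this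
    · rintro ⟨N, hN, hg⟩
      refine ⟨⟨N, mem_nonZeroDivisors_of_ne_zero hN⟩, ?_⟩
      change N • R.toIntSubmodule.mkQ g = 0
      rw [← map_smul, Submodule.mkQ_apply, Submodule.Quotient.mk_eq_zero]
      exact hg
  let b := Module.finBasis ℤ F
  choose γ hγ using fun i => hf (b i)
  refine ⟨_, γ, fun i => ((b.coord i).comp f).toAddMonoidHom, fun i j => ?_, fun g => ?_⟩
  · change b.coord i (f (γ j)) = _
    rw [hγ, Module.Basis.coord_apply, b.repr_self, Finsupp.single_apply]
    simp only [eq_comm]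
  · rw [← hker, ← b.forall_coord_eq_zero_iff]
    rfl

/-- On characters trivial on `R`, finitely many coordinates are locally injective. -/
theorem AddSubgroup.exists_local_coordinates {Γ : Type*} [AddCommGroup Γ] [Module.Finite ℤ Γ]
    (R : AddSubgroup Γ) : ∃ (d : ℕ) (γ : Fin d → Γ) (n : Fin d → Γ →+ ℤ),
      (∀ i j, n i (γ j) = if i = j then 1 else 0) ∧ (∀ i, ∀ g ∈ R, n i g = 0) ∧
      ∃ (T : Finset Γ) (ε : ℝ), 0 < ε ∧ (∀ τ ∈ T, ∀ i, n i τ = 0) ∧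
        ∀ φ : AddChar Γ ℂ, (∀ g ∈ R, φ g = 1) → (∀ i, φ (γ i) = 1) →
          (∀ τ ∈ T, ‖φ τ - 1‖ < ε) → φ = 1 := by
  classical
  obtain ⟨d, γ, n, hδ, hn⟩ := R.exists_coordinates
  let f : Γ →ₗ[ℤ] (Fin d → ℤ) := LinearMap.pi fun i => (n i).toIntLinearMap
  have hker : ∀ g, g ∈ LinearMap.ker f ↔ ∀ i, n i g = 0 := fun g => by
    rw [LinearMap.mem_ker, funext_iff]; rfl
  -- T generates the elements with a nonzero multiple in R. A character trivial on R takes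
  -- root-of-unity values there, and these are isolated from 1.
  obtain ⟨T, hT⟩ := (isNoetherian_def.1 (inferInstance : IsNoetherian ℤ Γ)) (LinearMap.ker f)
  have hTn : ∀ τ ∈ T, ∀ i, n i τ = 0 := fun τ hτ => (hker τ).1 (hT ▸ Submodule.subset_span hτ)
  have hε : ∀ τ ∈ T, ∃ ε > 0, ∀ φ : AddChar Γ ℂ, (∀ g ∈ R, φ g = 1) → ‖φ τ - 1‖ < ε →
      φ τ = 1 := by
    intro τ hτ
    obtain ⟨N, hN, hNτ⟩ := (hn τ).1 (hTn τ hτ)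
    have hfin : ({z : ℂ | z ^ N.natAbs = 1} \ {1}).Finite := by
      refine Set.Finite.sdiff ?_
      have h0 : (Polynomial.X ^ N.natAbs - 1 : Polynomial ℂ) ≠ 0 :=
        Polynomial.X_pow_sub_C_ne_zero (by omega) 1
      refine ((Polynomial.X ^ N.natAbs - 1 : Polynomial ℂ).roots.toFinset.finite_toSet).subset
        fun z hz => ?_
      have hz : z ^ N.natAbs = 1 := hz
      simp [h0, hz]
    obtain ⟨ε, hε, hball⟩ := Metric.isOpen_iff.1 hfin.isClosed.isOpen_compl 1 (by simp)
    refine ⟨ε, hε, fun φ hφ hc => ?_⟩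
    by_contra hne
    refine hball (Metric.mem_ball.2 ((dist_eq_norm _ _).trans_lt hc)) ⟨?_, hne⟩
    change φ τ ^ N.natAbs = 1
    rw [← AddChar.map_nsmul_eq_pow, ← natCast_zsmul]
    refine hφ _ ?_
    rcases Int.natAbs_eq N with h | h
    · rwa [← h]
    · rw [show ((N.natAbs : ℤ)) = -N by omega, neg_smul]
      exact R.neg_mem hNτ
  choose! ε hε0 hε using hε
  obtain ⟨e, he0, he⟩ : ∃ e > 0, ∀ τ ∈ T, e ≤ ε τ := by
    rcases T.eq_empty_or_nonempty with h | h
    · exact ⟨1, one_pos, by simp [h]⟩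
    · exact ⟨T.inf' h ε, (Finset.lt_inf'_iff h).2 hε0, fun τ hτ => Finset.inf'_le _ hτ⟩
  refine ⟨d, γ, n, hδ, fun i g hg => (hn g).2 ⟨1, one_ne_zero, by simpa using hg⟩ i, T, e, he0,
    hTn, fun φ hR hγ hφ => ?_⟩
  let κ : AddSubgroup Γ :=
    { carrier := {g | φ g = 1}
      zero_mem' := φ.map_zero_eq_one
      add_mem' := fun {a b} ha hb => by
        change φ (a + b) = 1
        rw [AddChar.map_add_eq_mul, show φ a = 1 from ha, show φ b = 1 from hb, one_mul]
      neg_mem' := fun {a} ha => by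
        change φ (-a) = 1
        rw [AddChar.map_neg_eq_inv, show φ a = 1 from ha, inv_one] }
  have h1 : LinearMap.ker f ≤ κ.toIntSubmodule := by
    rw [← hT, Submodule.span_le]
    exact fun τ hτ => hε τ hτ φ hR ((hφ τ hτ).trans_le (he τ hτ))
  ext g
  have h2 : g - ∑ i, n i g • γ i ∈ κ := h1 ((hker _).2 fun i => by simp [hδ])
  have h3 : ∑ i, n i g • γ i ∈ κ := κ.sum_mem fun i _ => κ.zsmul_mem (hγ i) _
  simpa using! κ.add_mem h2 h3

/-- Independence over ℤ persists over ℝ: a real relation makes the integral Gram matrix B = A Aᵀ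
singular, hence B w = 0 for an integral w ≠ 0, and wᵀ B w is the sum of squares of the entries of wᵀ
A. -/
theorem LinearIndependent.sum_mul_intCast_ne_zero {d d' : ℕ} {A : Fin d' → Fin d → ℤ}
    (hA : LinearIndependent ℤ A) {v : Fin d' → ℝ} (hv : v ≠ 0) :
    (fun j => ∑ a, v a * (A a j : ℝ)) ≠ 0 := by
  intro h0
  let B : Matrix (Fin d') (Fin d') ℤ := Matrix.of fun a b => ∑ j, A a j * A b j
  have h1 : (B.map (Int.castRingHom ℝ)).mulVec v = 0 := by
    ext a
    have : ∑ j, (A a j : ℝ) * ∑ b, v b * (A b j : ℝ) = 0 :=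
      Finset.sum_eq_zero fun j _ => by rw [congrFun h0 j, Pi.zero_apply, mul_zero]
    rw [Pi.zero_apply, ← this]
    simp only [Matrix.mulVec, dotProduct, B, Matrix.map_apply, Matrix.of_apply, map_sum, map_mul,
      eq_intCast, Finset.sum_mul, Finset.mul_sum]
    rw [Finset.sum_comm]
    exact Finset.sum_congr rfl fun j _ => Finset.sum_congr rfl fun b _ => by ring
  have h2 := Matrix.exists_mulVec_eq_zero_iff.1 ⟨v, hv, h1⟩
  rw [← RingHom.mapMatrix_apply, ← RingHom.map_det, eq_intCast, Int.cast_eq_zero] at h2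
  obtain ⟨w, hw, hBw⟩ := Matrix.exists_mulVec_eq_zero_iff.2 h2
  have h3 : ∑ j, (∑ a, w a * A a j) * (∑ a, w a * A a j) = 0 := by
    have : ∑ a, w a * (B.mulVec w) a = 0 := by simp [hBw]
    rw [← this]
    simp only [Matrix.mulVec, dotProduct, B, Matrix.of_apply, Finset.sum_mul, Finset.mul_sum]
    rw [Finset.sum_comm]
    refine Finset.sum_congr rfl fun a _ => ?_
    rw [Finset.sum_comm]
    exact Finset.sum_congr rfl fun b _ => Finset.sum_congr rfl fun j _ => by ring
  have h4 : ∀ j, ∑ a, w a * A a j = 0 := fun j =>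
    mul_self_eq_zero.1 ((Finset.sum_eq_zero_iff_of_nonneg fun j _ => mul_self_nonneg _).1 h3 j
      (Finset.mem_univ j))
  refine hw (funext (Fintype.linearIndependent_iff.1 hA w ?_))
  ext j
  simpa using h4 j

/-- Each subgroup has a finite generating set. Hence the domain has only countably many strata, as
second countability requires. -/
instance AddSubgroup.countable_of_finite_int {Γ : Type*} [AddCommGroup Γ] [Module.Finite ℤ Γ] :
    Countable (AddSubgroup Γ) := by
  have : Countable Γ := Finsupp.Countable.of_moduleFinite (R := ℤ)
  have h : ∀ K : AddSubgroup Γ, ∃ S : Finset Γ, Submodule.span ℤ (S : Set Γ) = K.toIntSubmodule :=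
    fun K => (isNoetherian_def.1 (inferInstance : IsNoetherian ℤ Γ)) _
  choose S hS using h
  refine Function.Injective.countable (f := S) fun K K' e => ?_
  exact AddSubgroup.toIntSubmodule.injective (by rw [← hS, ← hS, e])

end Lattices

namespace ExtHeis

variable {H H' C : Type*} [AddCommGroup H] [AddCommGroup H'] [AddCommGroup C]
variable (E : ExtHeis H H' C)

/-! ### The character lattice of the torus -/

/-- The lattice `H × H' × C × A` of characters of the torus `T_Ĝ`. -/
abbrev Lat : Type _ := H × H' × C × E.A

/-- A point of the torus as a character of the lattice. -/
def Torus.toChar {E : ExtHeis H H' C} (x : E.Torus) : AddChar E.Lat ℂ where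
  toFun := E.ev x
  map_zero_eq_one' := by simp [ev]
  map_add_eq_mul' a b := by
    simp only [ev, Prod.fst_add, Prod.snd_add, AddChar.map_add_eq_mul]; ring

@[simp] theorem Torus.toChar_apply {E : ExtHeis H H' C} (x : E.Torus) (a : E.Lat) :
    x.toChar a = E.ev x a := rfl

/-- The point of the torus that belongs to a character of the lattice. -/
def ofChar (φ : AddChar E.Lat ℂ) : E.Torus where
  chH := φ.compAddMonoidHom (AddMonoidHom.inl H (H' × C × E.A))
  chH' := φ.compAddMonoidHom ((AddMonoidHom.inr H (H' × C × E.A)).comp (AddMonoidHom.inl _ _))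
  chC := φ.compAddMonoidHom ((AddMonoidHom.inr H (H' × C × E.A)).comp
    ((AddMonoidHom.inr H' (C × E.A)).comp (AddMonoidHom.inl _ _)))
  chA := φ.compAddMonoidHom ((AddMonoidHom.inr H (H' × C × E.A)).comp
    ((AddMonoidHom.inr H' (C × E.A)).comp (AddMonoidHom.inr _ _)))

@[simp] theorem ev_ofChar (φ : AddChar E.Lat ℂ) (a : E.Lat) : E.ev (E.ofChar φ) a = φ a := by
  obtain ⟨m, p, c, l⟩ := a
  change φ (m, 0, 0, 0) * φ (0, p, 0, 0) * φ (0, 0, c, 0) * φ (0, 0, 0, l) = _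
  simp [← AddChar.map_add_eq_mul]

variable {E}

theorem ev_add (x : E.Torus) (a b : E.Lat) : E.ev x (a + b) = E.ev x a * E.ev x b :=
  x.toChar.map_add_eq_mul a b

theorem ev_ne_zero (x : E.Torus) (a : E.Lat) : E.ev x a ≠ 0 := by
  intro h
  have := ev_add x a (-a)
  rw [h, zero_mul, add_neg_cancel] at this
  exact one_ne_zero (x.toChar.map_zero_eq_one.symm.trans this)

@[simp] theorem ev_fst (x : E.Torus) (m : H) : E.ev x (m, 0, 0, 0) = x.chH m := by simp [ev]

@[simp] theorem ev_snd (x : E.Torus) (p : H') : E.ev x (0, p, 0, 0) = x.chH' p := by simp [ev]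

@[simp] theorem ev_trd (x : E.Torus) (c : C) : E.ev x (0, 0, c, 0) = x.chC c := by simp [ev]

@[simp] theorem ev_fth (x : E.Torus) (l : E.A) : E.ev x (0, 0, 0, l) = x.chA l := by simp [ev]

theorem torus_ext {x y : E.Torus} (h : ∀ a, E.ev x a = E.ev y a) : x = y := by
  ext a
  · simpa using h (a, 0, 0, 0)
  · simpa using h (0, a, 0, 0)
  · simpa using h (0, 0, a, 0)
  · simpa using h (0, 0, 0, a)

variable (E)

/-- The action of `h ∈ H` on the torus in terms of the lattice of its characters. -/
def shift (h : H) : E.Lat →+ E.Lat where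
  toFun a := (a.1, a.2.1 + a.2.2.2.1 h, a.2.2.1 + E.pairing h a.2.1 + E.half a.2.2.2 h, a.2.2.2)
  map_zero' := by simp [half_zero_left]
  map_add' a b := by
    ext
    · rfl
    · simp only [Prod.snd_add, Prod.fst_add, AddSubgroup.coe_add, AddMonoidHom.add_apply]; abel
    · simp only [Prod.snd_add, Prod.fst_add, map_add, half_add_left]; abel
    · rfl

theorem shift_apply (h : H) (a : E.Lat) : E.shift h a =
    (a.1, a.2.1 + a.2.2.2.1 h, a.2.2.1 + E.pairing h a.2.1 + E.half a.2.2.2 h, a.2.2.2) := rfl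

/-- The cross term of `half_add` is what ⟨h, ·⟩ contributes on the displacement of the H'-component
by h'. -/
theorem shift_shift (h h' : H) (a : E.Lat) : E.shift h (E.shift h' a) = E.shift (h + h') a := by
  simp only [shift_apply, map_add, AddMonoidHom.add_apply, half_add]
  refine Prod.ext rfl (Prod.ext ?_ (Prod.ext ?_ rfl)) <;> dsimp only <;> abel

@[simp] theorem shift_zero (a : E.Lat) : E.shift 0 a = a := by
  simp [shift_apply, half_zero]

theorem ev_act (t : AddChar H ℂ) (h : H) (x : E.Torus) (a : E.Lat) :
    E.ev (E.act t h x) a = t a.1 * E.ev x (E.shift h a) := by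
  simp only [ev, act, shift_apply, AddChar.coe_mk, AddChar.mul_apply, AddChar.map_add_eq_mul]
  ring

variable {E}

/-- The factor picked up is χ_C⟨n, p⟩ = 1 times the left side of the extendability condition. Hence
shifts of χ̂ depend only on the class in H/H_χ. -/
theorem Extendable.ev_shift {x : E.Torus} (hx : E.Extendable x) {n : H} (hn : n ∈ E.ker x.chC)
    (a : E.Lat) : E.ev x (E.shift n a) = E.ev x a := by
  have h1 := hx a.2.2.2 n hn
  have h2 := hn a.2.1
  simp only [ev, shift_apply, AddChar.map_add_eq_mul, h2]
  linear_combination (x.chH a.1 * x.chH' a.2.1 * x.chC a.2.2.1 * x.chA a.2.2.2) * h1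

theorem Extendable.ev_shift_congr {x : E.Torus} (hx : E.Extendable x) {n n' : H}
    (hn : n - n' ∈ E.ker x.chC) (a : E.Lat) : E.ev x (E.shift n a) = E.ev x (E.shift n' a) := by
  rw [← hx.ev_shift hn (E.shift n' a), shift_shift, sub_add_cancel]

theorem Extendable.act {x : E.Torus} (hx : E.Extendable x) (t : AddChar H ℂ) (h : H) :
    E.Extendable (E.act t h x) := by
  intro k m hm
  have h1 := hx k m hm
  have h2 : x.chC (E.pairing h (k.1 m)) = 1 := by rw [E.symm]; exact hm _
  change x.chH' (k.1 m) * x.chC (E.pairing h (k.1 m)) * x.chC (E.half k m) = 1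
  rw [h2, mul_one, h1]

/-- `y = (t, h) x` for some `t` that is trivial on `H_χ`. -/
def Rel (E : ExtHeis H H' C) (h : H) (x y : E.Torus) : Prop :=
  ∃ t : AddChar H ℂ, (∀ m ∈ E.ker x.chC, t m = 1) ∧ y = E.act t h x

/-- This eliminates t: it is invisible on lattice elements whose first component lies in H_χ, and it
is recovered as the quotient of the two characters of H. -/
theorem rel_iff {h : H} {x y : E.Torus} :
    E.Rel h x y ↔ ∀ a : E.Lat, a.1 ∈ E.ker x.chC → E.ev y a = E.ev x (E.shift h a) := by
  constructor
  · rintro ⟨t, ht, rfl⟩ a ha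
    rw [ev_act, ht _ ha, one_mul]
  · intro H0
    refine ⟨y.chH * x.chH⁻¹, fun m hm => ?_, torus_ext fun a => ?_⟩
    · have h1 := H0 (m, 0, 0, 0) hm
      have h2 : E.shift h (m, 0, 0, 0) = (m, 0, 0, 0) := by simp [shift_apply, half_zero_left]
      have h3 : x.chH (-m) * x.chH m = 1 := by rw [← AddChar.map_add_eq_mul]; simp
      rw [h2, ev_fst, ev_fst] at h1
      rw [AddChar.mul_apply, AddChar.inv_apply, h1, mul_comm, h3]
    · have h1 := H0 (0, a.2) (E.ker x.chC).zero_mem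
      have h2 : a = (a.1, 0, 0, 0) + (0, a.2) := Prod.ext (add_zero _).symm (zero_add _).symm
      have h3 : x.chH (-a.1) * x.chH a.1 = 1 := by rw [← AddChar.map_add_eq_mul]; simp
      have h4 : E.shift h (a.1, 0, 0, 0) = (a.1, 0, 0, 0) := by simp [shift_apply, half_zero_left]
      have h5 : E.ev y a = y.chH a.1 * E.ev x (E.shift h (0, a.2)) := by
        conv_lhs => rw [h2]
        rw [ev_add, h1, ev_fst]
      have h6 : E.ev x (E.shift h a) = x.chH a.1 * E.ev x (E.shift h (0, a.2)) := by
        conv_lhs => rw [h2]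
        rw [map_add, ev_add, h4, ev_fst]
      rw [ev_act, h5, h6, AddChar.mul_apply, AddChar.inv_apply]
      linear_combination -(y.chH a.1 * E.ev x (E.shift h (0, a.2))) * h3

theorem Rel.chC {h : H} {x y : E.Torus} (r : E.Rel h x y) : y.chC = x.chC := by
  obtain ⟨t, -, rfl⟩ := r
  rfl

theorem Rel.congr {h h' : H} {x y : E.Torus} (r : E.Rel h x y) (hx : E.Extendable x)
    (hh : h - h' ∈ E.ker x.chC) : E.Rel h' x y :=
  rel_iff.2 fun a ha => by rw [rel_iff.1 r a ha, hx.ev_shift_congr hh]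

theorem Rel.symm {h : H} {x y : E.Torus} (r : E.Rel h x y) : E.Rel (-h) y x := by
  have e := r.chC
  rw [rel_iff] at r ⊢
  intro a ha
  rw [e] at ha
  rw [r (E.shift (-h) a) ha, shift_shift, add_neg_cancel, shift_zero]

/-! ### Matrix elements -/

variable (E) in
/-- The coordinates of an element of `Ĝ`. -/
def lat (g : E.Ghat) : E.Lat := (g.left.m, g.left.p, g.left.c, E.rot g)

variable (E) in
/-- The element of `Ĝ` with given coordinates. -/
def ghat (a : E.Lat) : E.Ghat := ⟨⟨a.1, a.2.1, a.2.2.1⟩, Multiplicative.ofAdd a.2.2.2⟩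

@[simp] theorem lat_ghat (a : E.Lat) : E.lat (E.ghat a) = a := rfl

theorem rep_apply (x : E.ExtChar) (g : E.Ghat) (f : E.V x.1) (y : E.Heis) :
    (E.rep x g f).1 y = x.1.chA (E.rot g) * f.1 (E.aut (E.rot g) (y * g.left)) := rfl

theorem V_apply_mk_mul {x : E.Torus} {f : E.Heis → ℂ} (hf : f ∈ E.V x) {m : H}
    (hm : m ∈ E.ker x.chC) (p : H') (c : C) (g : E.Heis) :
    f (⟨m, p, c⟩ * g) = E.chi x ⟨m, p, c⟩ * f g :=
  hf.1 ⟨m, p, c⟩ hm g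

/-- Such g is diagonal with respect to the cosets of G_χ; its eigenvalues are the terms of the theta
series. -/
theorem rep_apply_of_mem (x : E.ExtChar) (g : E.Ghat) (hg : g.left.m ∈ E.ker x.1.chC)
    (f : E.V x.1) (n : H) :
    (E.rep x g f).1 ⟨n, 0, 0⟩ = E.ev x.1 (E.shift n (E.lat g)) * f.1 ⟨n, 0, 0⟩ := by
  rw [rep_apply]
  have e : E.aut (E.rot g) (⟨n, 0, 0⟩ * g.left)
      = ⟨g.left.m, g.left.p + (E.rot g).1 (g.left.m + n),
          g.left.c + E.pairing n g.left.p + E.half (E.rot g) (g.left.m + n)⟩ * ⟨n, 0, 0⟩ := by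
    ext
    · exact add_comm _ _
    · change 0 + g.left.p + (E.rot g).1 (n + g.left.m) = _ + 0
      rw [add_comm n]; abel_nf
    · change 0 + g.left.c + E.pairing n g.left.p + E.half (E.rot g) (n + g.left.m)
        = _ + 0 + E.pairing _ 0
      rw [add_comm n, map_zero]; abel_nf
  rw [e, V_apply_mk_mul f.2 hg, ← mul_assoc]
  congr 1
  -- The automorphism sees m + n instead of n, which is the same class modulo H_χ.
  rw [← x.2.ev_shift_congr (n := g.left.m + n) (by simpa using hg)]
  have h2 := hg g.left.p
  simp only [ev, chi, shift_apply, lat, map_add, AddMonoidHom.add_apply, AddChar.map_add_eq_mul, h2]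
  ring

theorem basisFun_base (x : E.Torus) (n : H ⧸ E.ker x.chC) :
    (E.basisFun x n).1 (E.base x.chC n) = 1 := by
  have h1 : E.base x.chC n * (E.base x.chC n)⁻¹ = 1 := mul_inv_cancel _
  have h2 : (1 : E.Heis) ∈ E.subG x.chC := (E.subG x.chC).one_mem
  refine (if_pos (h1 ▸ h2)).trans ?_
  rw [h1]
  simp [chi]

theorem diagCoeff_of_mem (x : E.ExtChar) (g : E.Ghat) (hg : g.left.m ∈ E.ker x.1.chC)
    (n : H ⧸ E.ker x.1.chC) :
    E.diagCoeff x g n = E.ev x.1 (E.shift n.out (E.lat g)) := by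
  have h := rep_apply_of_mem x g hg (E.basisFun x.1 n) n.out
  have h2 : (E.basisFun x.1 n).1 ⟨n.out, 0, 0⟩ = 1 := basisFun_base x.1 n
  rw [h2, mul_one] at h
  exact h

theorem diagCoeff_of_notMem (x : E.ExtChar) (g : E.Ghat) (hg : g.left.m ∉ E.ker x.1.chC)
    (n : H ⧸ E.ker x.1.chC) : E.diagCoeff x g n = 0 := by
  unfold diagCoeff
  rw [rep_apply]
  refine mul_eq_zero_of_right _ (if_neg fun h => hg ?_)
  have h : n.out + g.left.m + -n.out ∈ E.ker x.1.chC := h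
  simpa using h

/-! ### Equivalence of the representations -/

theorem translate_left_mem {x y : E.Torus} {h : H} (r : E.Rel h x y) {f : E.Heis → ℂ}
    (hf : f ∈ E.V x) : (fun g => f (⟨h, 0, 0⟩ * g)) ∈ E.V y := by
  classical
  have ec := r.chC
  obtain ⟨S, hS⟩ := hf.2
  refine ⟨fun u hu g => ?_, S.image fun s => ⟨-h, 0, 0⟩ * s, fun g hg => ?_⟩
  · have hu : u.m ∈ E.ker x.chC := by rw [← ec]; exact hu
    -- Moving u past (h, 0, 0) adds ⟨h, u.p⟩ to the central component: this is the twist of χ_H' in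
    -- the action.
    have e : (⟨h, 0, 0⟩ : E.Heis) * (u * g)
        = (⟨u.m, u.p, u.c + E.pairing h u.p⟩ : E.Heis) * (⟨h, 0, 0⟩ * g) := by
      ext
      · change h + (u.m + g.m) = u.m + (h + g.m); abel
      · change 0 + (u.p + g.p) = u.p + (0 + g.p); abel
      · change 0 + (u.c + g.c + E.pairing u.m g.p) + E.pairing h (u.p + g.p)
          = u.c + E.pairing h u.p + (0 + g.c + E.pairing h g.p) + E.pairing u.m (0 + g.p)
        rw [zero_add g.p, map_add]; abel
    simp only [e]
    rw [V_apply_mk_mul hf hu]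
    congr 1
    obtain ⟨t, ht, rfl⟩ := r
    simp only [chi, act, AddChar.coe_mk, AddChar.mul_apply, AddChar.map_add_eq_mul, ht _ hu]
    ring
  · obtain ⟨s, hs, hs'⟩ := hS _ hg
    refine ⟨_, Finset.mem_image_of_mem _ hs, ?_⟩
    have hs' : h + g.m + -s.m ∈ E.ker x.chC := hs'
    change g.m + -(-h + s.m) ∈ E.ker y.chC
    rw [ec]
    convert hs' using 1
    abel

/-- Left translation by `h` as a map between the spaces of two representations. -/
def translateLeft {x y : E.Torus} {h : H} (r : E.Rel h x y) : E.V x →ₗ[ℂ] E.V y where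
  toFun f := ⟨fun g => f.1 (⟨h, 0, 0⟩ * g), translate_left_mem r f.2⟩
  map_add' _ _ := rfl
  map_smul' _ _ := rfl

theorem equivalent_of_rel {x y : E.ExtChar} {h : H} (r : E.Rel h x.1 y.1) :
    E.Equivalent x y := by
  have h1 : (⟨h, 0, 0⟩ : E.Heis) * ⟨-h, 0, 0⟩ = 1 := by
    ext <;> simp
  have h2 : (⟨-h, 0, 0⟩ : E.Heis) * ⟨h, 0, 0⟩ = 1 := by
    ext <;> simp
  refine ⟨Representation.Equiv.mk (LinearEquiv.ofLinearMap (translateLeft r) (translateLeft r.symm)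
    ?_ ?_) fun g => ?_⟩
  · ext f g
    change f.1 (⟨-h, 0, 0⟩ * (⟨h, 0, 0⟩ * g)) = f.1 g
    rw [← mul_assoc, h2, one_mul]
  · ext f g
    change f.1 (⟨h, 0, 0⟩ * (⟨-h, 0, 0⟩ * g)) = f.1 g
    rw [← mul_assoc, h1, one_mul]
  · ext f u
    change x.1.chA (E.rot g) * f.1 (E.aut (E.rot g) (⟨h, 0, 0⟩ * u * g.left))
      = y.1.chA (E.rot g) * f.1 (⟨h, 0, 0⟩ * E.aut (E.rot g) (u * g.left))
    -- The automorphism takes (h, 0, 0) to (0, k h, ½⟨h − r, k h⟩)(h, 0, 0); χ of the first factor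
    -- is the change of χ_A under the action.
    have e : E.aut (E.rot g) (⟨h, 0, 0⟩ * u * g.left)
        = ⟨0, (E.rot g).1 h, E.half (E.rot g) h⟩ * (⟨h, 0, 0⟩ * E.aut (E.rot g) (u * g.left)) := by
      rw [mul_assoc, map_mul, ← mul_assoc]
      congr 1
      ext
      · exact (zero_add h).symm
      · change 0 + (E.rot g).1 h = (E.rot g).1 h + 0
        abel
      · change 0 + E.half (E.rot g) h = E.half (E.rot g) h + 0 + E.pairing 0 0
        rw [map_zero]; abel
    rw [e, V_apply_mk_mul f.2 (E.ker x.1.chC).zero_mem]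
    obtain ⟨t, ht, e'⟩ := r
    rw [e']
    simp only [chi, act, AddChar.coe_mk, AddChar.map_zero_eq_one]
    ring

theorem chi_mul (x : E.Torus) {g g' : E.Heis} (hg : g ∈ E.subG x.chC) :
    E.chi x (g * g') = E.chi x g * E.chi x g' := by
  have h : x.chC (E.pairing g.m g'.p) = 1 := hg _
  simp only [chi, mul_m, mul_p, mul_c, AddChar.map_add_eq_mul, h]
  ring

/-- A function in `V_χ` that is supported on `G_χ` is an eigenvector of `G_χ` and `A`. -/
theorem rep_apply_of_support (x : E.ExtChar) (f : E.V x.1)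
    (hf : ∀ u, u ∉ E.subG x.1.chC → f.1 u = 0) (g : E.Ghat) (hg : g.left.m ∈ E.ker x.1.chC) :
    E.rep x g f = E.ev x.1 (E.lat g) • f := by
  ext u
  rw [rep_apply]
  change _ = E.ev x.1 (E.lat g) * f.1 u
  by_cases hu : u ∈ E.subG x.1.chC
  · have hug : u * g.left ∈ E.subG x.1.chC := (E.subG _).mul_mem hu hg
    have h1 := f.2.1 _ ((E.aut_mem _ (E.rot g) _).2 hug) 1
    have h2 := f.2.1 _ hu 1
    rw [mul_one] at h1 h2
    rw [h1, h2, E.chi_aut x _ hug, chi_mul _ hu]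
    simp only [chi, ev, lat]
    ring
  · have h : E.aut (E.rot g) (u * g.left) ∉ E.subG x.1.chC := by
      rw [E.aut_mem, Subgroup.mul_mem_cancel_right _ hg]
      exact hu
    rw [hf _ h, hf _ hu, mul_zero, mul_zero]

/-- The basis vector of V_y supported on the trivial coset is a joint eigenvector with character ŷ.
Its preimage f in V_x has the same eigenvalues, and at any n with f(n, 0, 0) ≠ 0 they equal x̂
shifted by n. -/
theorem rel_of_equivalent {x y : E.ExtChar} (h : E.Equivalent x y) : ∃ n, E.Rel n x.1 y.1 := by
  obtain ⟨T⟩ := h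
  set f₀ := E.basisFun y.1 0 with hf₀
  have hout : Quotient.out (0 : H ⧸ E.ker y.1.chC) ∈ E.ker y.1.chC := by
    rw [← QuotientAddGroup.eq_zero_iff]
    exact Quotient.out_eq _
  have hsupp : ∀ u, u ∉ E.subG y.1.chC → f₀.1 u = 0 := by
    intro u hu
    refine if_neg fun h => hu ?_
    have h : u.m + -Quotient.out (0 : H ⧸ E.ker y.1.chC) ∈ E.ker y.1.chC := h
    change u.m ∈ E.ker y.1.chC
    simpa using (E.ker y.1.chC).add_mem h hout
  have hf0 : f₀ ≠ 0 := fun h => by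
    have h1 := basisFun_base y.1 0
    rw [← hf₀, h] at h1
    exact zero_ne_one h1
  set f := T.symm f₀ with hf
  have hfne : f ≠ 0 := fun h => hf0 (by
    have h3 := T.apply_symm_apply f₀
    rw [← hf, h, map_zero] at h3
    exact h3.symm)
  obtain ⟨n, hn⟩ : ∃ n : H, f.1 ⟨n, 0, 0⟩ ≠ 0 := by
    by_contra! hcon
    refine hfne (Subtype.ext (funext fun u => ?_))
    have e : u = (⟨0, u.p, u.c⟩ : E.Heis) * ⟨u.m, 0, 0⟩ := by ext <;> simp
    rw [e, V_apply_mk_mul f.2 (E.ker x.1.chC).zero_mem, hcon, mul_zero]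
    rfl
  have heig : ∀ g : E.Ghat, g.left.m ∈ E.ker y.1.chC → E.rep x g f = E.ev y.1 (E.lat g) • f := by
    intro g hg
    have h1 := LinearMap.congr_fun (T.symm.isIntertwining' g) f₀
    have h2 : T.symm (E.rep y g f₀) = E.rep x g f := h1
    rw [← h2, rep_apply_of_support y f₀ hsupp g hg, map_smul]
  -- The two kernels are not yet known to agree; the case a ∈ C gives equality of the χ_C and hence
  -- of the kernels.
  have key : ∀ a : E.Lat, a.1 ∈ E.ker y.1.chC → a.1 ∈ E.ker x.1.chC →
      E.ev y.1 a = E.ev x.1 (E.shift n a) := by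
    intro a ha ha'
    have h1 := congrArg (fun f : E.V x.1 => f.1 ⟨n, 0, 0⟩) (heig (E.ghat a) ha)
    simp only [rep_apply_of_mem x (E.ghat a) ha' f n, lat_ghat] at h1
    exact (mul_right_cancel₀ hn h1).symm
  have hC : y.1.chC = x.1.chC := by
    ext c
    have := key (0, 0, c, 0) (E.ker _).zero_mem (E.ker _).zero_mem
    simpa [shift_apply, half_zero_left] using this
  exact ⟨n, rel_iff.2 fun a ha => key a (by rw [hC]; exact ha) ha⟩

theorem equivalent_iff {x y : E.ExtChar} : E.Equivalent x y ↔ ∃ n, E.Rel n x.1 y.1 :=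
  ⟨rel_of_equivalent, fun ⟨_, r⟩ => equivalent_of_rel r⟩

end ExtHeis

namespace ExtHeis

variable {H H' C : Type*} [AddCommGroup H] [AddCommGroup H'] [AddCommGroup C]

/-! ### The quadratic form `-log |χ_C ⟨n, k n⟩|` -/

/-- `m ↦ -log |φ (m)|` for a complex character `φ`. -/
noncomputable def negLog {M : Type*} [AddCommGroup M] (φ : AddChar M ℂ) : M →+ ℝ where
  toFun m := -Real.log ‖φ m‖
  map_zero' := by simp
  map_add' a b := by
    have h : ∀ a, φ a ≠ 0 := fun a h => by
      have := φ.map_add_eq_mul a (-a)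
      rw [h, zero_mul, add_neg_cancel, φ.map_zero_eq_one] at this
      exact one_ne_zero this
    rw [φ.map_add_eq_mul, norm_mul,
      Real.log_mul (norm_ne_zero_iff.2 (h a)) (norm_ne_zero_iff.2 (h b))]
    ring

theorem negLog_apply {M : Type*} [AddCommGroup M] (φ : AddChar M ℂ) (m : M) :
    negLog φ m = -Real.log ‖φ m‖ := rfl

theorem negLog_of_eq_one {M : Type*} [AddCommGroup M] {φ : AddChar M ℂ} {m : M} (h : φ m = 1) :
    negLog φ m = 0 := by simp [negLog_apply, h]

theorem exp_neg_negLog {M : Type*} [AddCommGroup M] (φ : AddChar M ℂ) (m : M) :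
    Real.exp (-negLog φ m) = ‖φ m‖ := by
  have h : φ m ≠ 0 := fun h => by
    have := φ.map_add_eq_mul m (-m)
    rw [h, zero_mul, add_neg_cancel, φ.map_zero_eq_one] at this
    exact one_ne_zero this
  rw [negLog_apply, neg_neg, Real.exp_log (norm_pos_iff.2 h)]

variable (E : ExtHeis H H' C)

/-- The symmetric bilinear form `(m, n) ↦ -log |χ_C ⟨m, k n⟩|` on `H`. -/
noncomputable def form (k : E.A) (ψ : AddChar C ℂ) (m n : H) : ℝ :=
  negLog ψ (E.pairing m (k.1 n))

/-- The Gram matrix of the form. -/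
noncomputable def gram (k : E.A) (ψ : AddChar C ℂ) {d : ℕ} (e : Fin d → H) :
    Matrix (Fin d) (Fin d) ℝ :=
  Matrix.of fun i j => E.form k ψ (e i) (e j)

/-- The vectors `e` are a basis of `H` modulo `K` with coordinate functions `ν`. -/
structure IsCoord (K : AddSubgroup H) {d : ℕ} (e : Fin d → H) (ν : Fin d → H →+ ℤ) : Prop where
  dual : ∀ i j, ν i (e j) = if i = j then 1 else 0
  mem_iff : ∀ h, (∀ i, ν i h = 0) ↔ h ∈ K

namespace IsCoord

variable {K : AddSubgroup H} {d : ℕ} {e : Fin d → H} {ν : Fin d → H →+ ℤ}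

theorem coord_sum (hK : IsCoord K e ν) (a : Fin d → ℤ) (i : Fin d) :
    ν i (∑ j, a j • e j) = a i := by
  simp [hK.dual]

theorem sub_mem (hK : IsCoord K e ν) (h : H) : h - ∑ i, ν i h • e i ∈ K :=
  (hK.mem_iff _).1 fun i => by rw [map_sub, hK.coord_sum, sub_self]

theorem linearIndependent (hK : IsCoord K e ν) :
    LinearIndependent ℤ (fun i => (e i : H ⧸ K)) := by
  rw [Fintype.linearIndependent_iff]
  intro g hg i
  have : ((∑ i, g i • e i : H) : H ⧸ K) = 0 := by
    rw [← hg]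
    exact (map_sum (QuotientAddGroup.mk' K) _ _).trans (by simp)
  rw [QuotientAddGroup.eq_zero_iff, ← hK.mem_iff] at this
  simpa [hK.coord_sum] using this i

end IsCoord

variable {E} {k : E.A} {ψ : AddChar C ℂ}

variable (E) in
theorem pairing_of_mem_ker (ψ : AddChar C ℂ) : ∀ m ∈ E.ker ψ, ∀ p, ψ (E.pairing m p) = 1 :=
  fun _ hm => hm

theorem form_comm (m n : H) : E.form k ψ m n = E.form k ψ n m := by
  rw [form, form, E.symm]

theorem form_of_mem {K : AddSubgroup H} (hψ : ∀ m ∈ K, ∀ p, ψ (E.pairing m p) = 1) {m : H}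
    (hm : m ∈ K) (n : H) : E.form k ψ m n = 0 :=
  negLog_of_eq_one (hψ m hm _)

theorem form_sum_right {d : ℕ} (m : H) (a : Fin d → ℤ) (e : Fin d → H) :
    E.form k ψ m (∑ i, a i • e i) = ∑ i, (a i : ℝ) * E.form k ψ m (e i) := by
  simp only [form, map_sum, map_zsmul, zsmul_eq_mul]

theorem form_add_right (m n n' : H) :
    E.form k ψ m (n + n') = E.form k ψ m n + E.form k ψ m n' := by
  simp [form]

/-- K lies in the radical of the form. It is not assumed to be all of `E.ker ψ`, so that ψ may vary
near a character with kernel K. -/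
theorem form_eq_sum {K : AddSubgroup H} (hψ : ∀ m ∈ K, ∀ p, ψ (E.pairing m p) = 1) {d : ℕ}
    {e : Fin d → H} {ν : Fin d → H →+ ℤ} (hK : IsCoord K e ν) (m n : H) :
    E.form k ψ m n = ∑ i, ∑ j, (ν i m : ℝ) * (ν j n : ℝ) * E.gram k ψ e i j := by
  have key : ∀ m n, E.form k ψ m n = ∑ i, (ν i n : ℝ) * E.form k ψ m (e i) := by
    intro m n
    conv_lhs => rw [← sub_add_cancel n (∑ i, ν i n • e i)]
    rw [form_add_right, form_comm, form_of_mem hψ (hK.sub_mem n), zero_add, form_sum_right]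
  rw [form_comm, key]
  refine Finset.sum_congr rfl fun i _ => ?_
  rw [form_comm, key, Finset.mul_sum]
  exact Finset.sum_congr rfl fun j _ => by rw [gram, Matrix.of_apply]; ring

/-- H/H_χ has no torsion: if N h ∈ H_χ with N ≠ 0, then the form vanishes at h, which forces h ∈
H_χ. -/
theorem exists_isCoord [Module.Finite ℤ H] (hk : k ∈ E.Apos ψ) :
    ∃ (d : ℕ) (e : Fin d → H) (ν : Fin d → H →+ ℤ), IsCoord (E.ker ψ) e ν := by
  obtain ⟨d, e, ν, h1, h2⟩ := (E.ker ψ).exists_coordinates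
  refine ⟨d, e, ν, h1, fun h => (h2 h).trans ⟨?_, fun hh => ⟨1, one_ne_zero, by simpa using hh⟩⟩⟩
  rintro ⟨N, hN, hNh⟩
  by_contra hcon
  have h3 := hk.1 h hcon
  have h4 : E.form k ψ h (N • h) = 0 := by
    rw [form_comm]
    exact form_of_mem (E.pairing_of_mem_ker _) hNh _
  have h5 : E.form k ψ h h = 0 := by
    simpa [form, hN] using h4
  rw [← exp_neg_negLog, show negLog ψ (E.pairing h (k.1 h)) = 0 from h5] at h3
  simp at h3

theorem gram_posDef {d : ℕ} {e : Fin d → H} {ν : Fin d → H →+ ℤ} (hk : k ∈ E.Apos ψ)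
    (hK : IsCoord (E.ker ψ) e ν) : (E.gram k ψ e).PosDef :=
  hk.2 d e hK.linearIndependent

/-- One lower bound gives both claims: an element of the kernel outside K would have form value 0,
and Gram matrices of other independent families are pulled back along a real-injective map. This
makes the conditions on χ_C open among characters trivial on ⟨K, H'⟩. -/
theorem ker_eq_and_mem_Apos {K : AddSubgroup H} (hψ : ∀ m ∈ K, ∀ p, ψ (E.pairing m p) = 1) {d : ℕ}
    {e : Fin d → H} {ν : Fin d → H →+ ℤ} (hK : IsCoord K e ν) {c : ℝ} (hc : 0 < c)
    (hlow : ∀ v : Fin d → ℝ, c * ∑ i, v i ^ 2 ≤ ∑ i, ∑ j, v i * v j * E.gram k ψ e i j) :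
    E.ker ψ = K ∧ k ∈ E.Apos ψ := by
  have hpos : ∀ v : Fin d → ℝ, v ≠ 0 → 0 < ∑ i, ∑ j, v i * v j * E.gram k ψ e i j := by
    intro v hv
    refine lt_of_lt_of_le (mul_pos hc ?_) (hlow v)
    obtain ⟨i, hi⟩ := Function.ne_iff.1 hv
    exact Finset.sum_pos' (fun i _ => sq_nonneg _)
      ⟨i, Finset.mem_univ _, by have : v i ≠ 0 := hi; positivity⟩
  have hlt : ∀ n, n ∉ K → ‖ψ (E.pairing n (k.1 n))‖ < 1 := by
    intro n hn
    rw [← exp_neg_negLog, Real.exp_lt_one_iff, neg_lt_zero]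
    change 0 < E.form k ψ n n
    rw [form_eq_sum hψ hK]
    refine hpos (fun i => (ν i n : ℝ)) fun h => hn ((hK.mem_iff n).1 fun i => ?_)
    have := congrFun h i
    simpa using this
  have hker : E.ker ψ = K := by
    refine le_antisymm (fun n hn => ?_) fun n hn => hψ n hn
    by_contra hcon
    have := hlt n hcon
    rw [hn (k.1 n)] at this
    simp at this
  refine ⟨hker, fun n hn => hlt n (by rwa [← hker]), fun d' f hf => ?_⟩
  rw [Matrix.posDef_iff_dotProduct_mulVec]
  refine ⟨?_, fun v hv => ?_⟩
  · ext i j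
    exact form_comm (E := E) (k := k) (ψ := ψ) _ _
  · rw [hker] at hf
    have hA : LinearIndependent ℤ (fun a i => ν i (f a)) := by
      rw [Fintype.linearIndependent_iff] at hf ⊢
      intro g hg
      refine hf g ?_
      have : ∑ a, g a • f a ∈ K := (hK.mem_iff _).1 fun i => by
        simpa using congrFun hg i
      rw [← QuotientAddGroup.eq_zero_iff] at this
      rw [← this]
      exact ((map_sum (QuotientAddGroup.mk' K) _ _).trans (by simp)).symm
    refine (hpos _ (hA.sum_mul_intCast_ne_zero hv)).trans_eq ?_
    have e1 : ∀ a b, -Real.log ‖ψ (E.pairing (f a) (k.1 (f b)))‖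
        = ∑ i, ∑ j, (ν i (f a) : ℝ) * (ν j (f b) : ℝ) * E.gram k ψ e i j :=
      fun a b => form_eq_sum hψ hK _ _
    calc _ = ∑ i, ∑ j, ∑ a, ∑ b,
          v a * (ν i (f a) : ℝ) * (v b * (ν j (f b) : ℝ)) * E.gram k ψ e i j := by
          simp only [Finset.sum_mul, Finset.mul_sum]
          exact Finset.sum_congr rfl fun i _ => Finset.sum_congr rfl fun j _ => Finset.sum_comm
      _ = ∑ a, ∑ b, ∑ i, ∑ j,
          v a * (ν i (f a) : ℝ) * (v b * (ν j (f b) : ℝ)) * E.gram k ψ e i j := by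
          rw [Finset.sum_congr rfl fun i _ => Finset.sum_comm, Finset.sum_comm]
          refine Finset.sum_congr rfl fun a _ => ?_
          rw [Finset.sum_congr rfl fun i _ => Finset.sum_comm, Finset.sum_comm]
      _ = _ := by
          simp only [dotProduct, Matrix.mulVec, Matrix.of_apply, Pi.star_apply, star_trivial, e1,
            Finset.sum_mul, Finset.mul_sum]
          exact Finset.sum_congr rfl fun a _ => Finset.sum_congr rfl fun b _ =>
            Finset.sum_congr rfl fun i _ => Finset.sum_congr rfl fun j _ => by ring

theorem gram_add_left {d : ℕ} (k l : E.A) (e : Fin d → H) (i j : Fin d) :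
    E.gram (k + l) ψ e i j = E.gram k ψ e i j + E.gram l ψ e i j := by
  simp [gram, form]

theorem gram_nsmul_left {d : ℕ} (N : ℕ) (k : E.A) (e : Fin d → H) (i j : Fin d) :
    E.gram (N • k) ψ e i j = N * E.gram k ψ e i j := by
  simp [gram, form]

/-- The cone `A (χ)` absorbs `A`. -/
theorem exists_nsmul_add_mem_Apos [Module.Finite ℤ H] (hk : k ∈ E.Apos ψ) (l : E.A) :
    ∃ N : ℕ, ∀ j ≥ N, j • k + l ∈ E.Apos ψ := by
  obtain ⟨d, e, ν, hK⟩ := exists_isCoord hk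
  obtain ⟨c, hc, hlow⟩ := (gram_posDef hk hK).exists_forall_mul_sum_sq_le
  have hlow := hlow (E.gram k ψ e) (fun _ _ => by simpa using hc.le)
  set B := ∑ i, ∑ j, |E.gram l ψ e i j| with hB
  -- The form of l is at least −B ∑ v_i², so j c ≥ B + 1 leaves at least ∑ v_i² for j k + l.
  obtain ⟨N, hN⟩ := exists_nat_gt ((B + 1) / c)
  refine ⟨N, fun j hj => (ker_eq_and_mem_Apos (E.pairing_of_mem_ker _) hK one_pos fun v => ?_).2⟩
  have h1 : -(B * ∑ i, v i ^ 2) ≤ ∑ a, ∑ b, v a * v b * E.gram l ψ e a b := by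
    rw [hB, Finset.sum_mul, ← Finset.sum_neg_distrib]
    refine Finset.sum_le_sum fun a _ => ?_
    rw [Finset.sum_mul, ← Finset.sum_neg_distrib]
    refine Finset.sum_le_sum fun b _ => neg_le_of_abs_le ?_
    rw [abs_mul, mul_comm]
    refine mul_le_mul_of_nonneg_left ?_ (abs_nonneg _)
    have ha := Finset.single_le_sum (f := fun i => v i ^ 2) (fun i _ => sq_nonneg _)
      (Finset.mem_univ a)
    have hb := Finset.single_le_sum (f := fun i => v i ^ 2) (fun i _ => sq_nonneg _)
      (Finset.mem_univ b)
    rw [abs_le]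
    constructor <;> nlinarith [sq_nonneg (v a + v b), sq_nonneg (v a - v b)]
  have h2 : ∑ a, ∑ b, v a * v b * E.gram (j • k + l) ψ e a b
      = j * ∑ a, ∑ b, v a * v b * E.gram k ψ e a b + ∑ a, ∑ b, v a * v b * E.gram l ψ e a b := by
    simp only [gram_add_left, gram_nsmul_left, Finset.mul_sum, ← Finset.sum_add_distrib]
    exact Finset.sum_congr rfl fun a _ => Finset.sum_congr rfl fun b _ => by ring
  rw [h2]
  have h3 : B + 1 ≤ j * c := by
    rw [div_lt_iff₀ hc] at hN
    have : (N : ℝ) ≤ j := by exact_mod_cast hj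
    nlinarith
  have h4 : 0 ≤ ∑ i, v i ^ 2 := Finset.sum_nonneg fun i _ => sq_nonneg _
  have h5 : (0 : ℝ) ≤ j := Nat.cast_nonneg j
  nlinarith [mul_le_mul_of_nonneg_left (hlow v) h5, mul_le_mul_of_nonneg_right h3 h4]

theorem nsmul_mem_Apos [Module.Finite ℤ H] (hk : k ∈ E.Apos ψ) {j : ℕ} (hj : 1 ≤ j) :
    j • k ∈ E.Apos ψ := by
  obtain ⟨d, e, ν, hK⟩ := exists_isCoord hk
  obtain ⟨c, hc, hlow⟩ := (gram_posDef hk hK).exists_forall_mul_sum_sq_le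
  have hlow := hlow (E.gram k ψ e) (fun _ _ => by simpa using hc.le)
  refine (ker_eq_and_mem_Apos (E.pairing_of_mem_ker _) hK hc fun v => ?_).2
  have h2 : ∑ a, ∑ b, v a * v b * E.gram (j • k) ψ e a b
      = j * ∑ a, ∑ b, v a * v b * E.gram k ψ e a b := by
    simp only [gram_nsmul_left, Finset.mul_sum]
    exact Finset.sum_congr rfl fun a _ => Finset.sum_congr rfl fun b _ => by ring
  rw [h2]
  have h4 : 0 ≤ ∑ i, v i ^ 2 := Finset.sum_nonneg fun i _ => sq_nonneg _
  have h5 : (1 : ℝ) ≤ j := by exact_mod_cast hj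
  nlinarith [hlow v, mul_nonneg hc.le h4]

/-! ### The topology of the domain -/

theorem continuous_ev (k : E.A) (a : E.Lat) : Continuous fun y : E.Dom k => E.ev y.1.1 a :=
  (continuous_apply a).comp
    (continuous_iff_le_induced.2 (inf_le_left : instTopologicalSpaceDom E k ≤ _))

theorem eventually_ker_eq (x : E.Dom k) :
    ∀ᶠ y in 𝓝 x, E.ker y.1.1.chC = E.ker x.1.1.chC := by
  let _ : TopologicalSpace (AddSubgroup H) := ⊥
  have : DiscreteTopology (AddSubgroup H) := ⟨rfl⟩
  have hc : Continuous fun y : E.Dom k => E.ker y.1.1.chC :=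
    continuous_iff_le_induced.2 (inf_le_right : instTopologicalSpaceDom E k ≤ _)
  exact (hc.continuousAt (x := x)).eventually
    (p := fun K => K = E.ker x.1.1.chC) (by rw [nhds_discrete]; simp)

theorem tendsto_dom {X : Type*} {l : Filter X} {f : X → E.Dom k} {x : E.Dom k}
    (h1 : ∀ a, Filter.Tendsto (fun z => E.ev (f z).1.1 a) l (𝓝 (E.ev x.1.1 a)))
    (h2 : ∀ᶠ z in l, E.ker (f z).1.1.chC = E.ker x.1.1.chC) : Filter.Tendsto f l (𝓝 x) := by
  let _ : TopologicalSpace (AddSubgroup H) := ⊥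
  have : DiscreteTopology (AddSubgroup H) := ⟨rfl⟩
  have e := @nhds_inf (E.Dom k)
    (TopologicalSpace.induced (fun x : E.Dom k => E.ev x.1.1) inferInstance)
    (TopologicalSpace.induced (fun x : E.Dom k => E.ker x.1.1.chC) ⊥) x
  rw [nhds_induced, nhds_induced] at e
  rw [show 𝓝 x = _ from e, Filter.tendsto_inf, Filter.tendsto_comap_iff, Filter.tendsto_comap_iff,
    nhds_discrete (α := AddSubgroup H), Filter.tendsto_pure]
  exact ⟨tendsto_pi_nhds.2 h1, h2⟩

theorem continuous_log_norm_ev (k : E.A) (a : E.Lat) :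
    Continuous fun y : E.Dom k => Real.log ‖E.ev y.1.1 a‖ :=
  (continuous_ev k a).norm.log fun _ => norm_ne_zero_iff.2 (ev_ne_zero _ _)

theorem continuous_gram (k l : E.A) {d : ℕ} (e : Fin d → H) (i j : Fin d) :
    Continuous fun y : E.Dom k => E.gram l y.1.1.chC e i j := by
  have := (continuous_log_norm_ev (E := E) k (0, 0, E.pairing (e i) (l.1 (e j)), 0)).neg
  exact this.congr fun y => by
    change -Real.log ‖E.ev y.1.1 _‖ = _
    rw [ev_trd]
    rfl

/-- The Gram matrices are uniformly positive definite near a point. -/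
theorem exists_gram_lower_bound (x : E.Dom k) {d : ℕ} {e : Fin d → H} {ν : Fin d → H →+ ℤ}
    (hK : IsCoord (E.ker x.1.1.chC) e ν) : ∃ c > 0, ∀ᶠ y in 𝓝 x, ∀ v : Fin d → ℝ,
      c * ∑ i, v i ^ 2 ≤ ∑ i, ∑ j, v i * v j * E.gram k y.1.1.chC e i j := by
  obtain ⟨c, hc, hlow⟩ := (gram_posDef x.2 hK).exists_forall_mul_sum_sq_le
  refine ⟨c, hc, ?_⟩
  have : ∀ᶠ y in 𝓝 x, ∀ i j, |E.gram k y.1.1.chC e i j - E.gram k x.1.1.chC e i j| < c := by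
    refine Filter.eventually_all.2 fun i => Filter.eventually_all.2 fun j => ?_
    exact (continuous_gram k k e i j).continuousAt.eventually (Metric.ball_mem_nhds _ hc)
  exact this.mono fun y hy => hlow _ fun i j => (hy i j).le

/-! ### Convergence of the traces -/

/-- Doubling removes the ambiguity of the half, so its modulus is determined by ⟨n − r, k n⟩. This
is the source of the Gaussian decay. -/
theorem log_norm_half (x : E.Torus) (n : H) :
    Real.log ‖x.chC (E.half k n)‖
      = -(E.form k x.chC n n) / 2 + E.form k x.chC E.r n / 2 := by
  have h := congrArg (negLog x.chC) (E.two_half k n)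
  rw [map_add, map_sub, AddMonoidHom.sub_apply, map_sub] at h
  have h2 : Real.log ‖x.chC (E.half k n)‖ = -negLog x.chC (E.half k n) := by
    rw [negLog_apply, neg_neg]
  rw [h2]
  simp only [form]
  linarith

/-- The linear part of the exponent of the theta series. -/
noncomputable def slope (x : E.Torus) (a : E.Lat) : H →+ ℝ where
  toFun n := Real.log ‖E.ev x (0, a.2.2.2.1 n, E.pairing n a.2.1, 0)‖
    + E.form a.2.2.2 x.chC E.r n / 2
  map_zero' := by simp [ev, form]
  map_add' m n := by
    have h : ((0, a.2.2.2.1 (m + n), E.pairing (m + n) a.2.1, 0) : E.Lat)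
        = (0, a.2.2.2.1 m, E.pairing m a.2.1, 0) + (0, a.2.2.2.1 n, E.pairing n a.2.1, 0) := by
      simp
    rw [h, ev_add, norm_mul, Real.log_mul (norm_ne_zero_iff.2 (ev_ne_zero _ _))
      (norm_ne_zero_iff.2 (ev_ne_zero _ _)), form_add_right]
    ring

theorem slope_apply (x : E.Torus) (a : E.Lat) (n : H) :
    slope x a n = Real.log ‖E.ev x (0, a.2.2.2.1 n, E.pairing n a.2.1, 0)‖
      + E.form a.2.2.2 x.chC E.r n / 2 := rfl

theorem norm_ev_shift (x : E.Torus) (a : E.Lat) (n : H) :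
    ‖E.ev x (E.shift n a)‖ = ‖E.ev x a‖ *
      Real.exp (slope x a n - E.form a.2.2.2 x.chC n n / 2) := by
  have h1 : E.shift n a = a + (0, a.2.2.2.1 n, E.pairing n a.2.1, 0)
      + (0, 0, E.half a.2.2.2 n, 0) := by
    refine Prod.ext ?_ (Prod.ext ?_ (Prod.ext ?_ ?_)) <;> simp [shift_apply]
  rw [h1, ev_add, ev_add, norm_mul, norm_mul, mul_assoc, ev_trd]
  congr 1
  rw [← Real.exp_log (norm_pos_iff.2 (ev_ne_zero x (0, a.2.2.2.1 n, E.pairing n a.2.1, 0))),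
    ← Real.exp_log (norm_pos_iff.2 (show x.chC (E.half a.2.2.2 n) ≠ 0 by
      rw [← ev_trd]; exact ev_ne_zero _ _)), log_norm_half, ← Real.exp_add, slope_apply]
  congr 1
  ring

/-- Replacing n by its coordinate combination makes the bound depend on finitely many quantities
that are continuous in χ̂, hence locally uniform. -/
theorem norm_ev_shift_le {x : E.Torus} (hx : E.Extendable x) {d : ℕ} {e : Fin d → H}
    {ν : Fin d → H →+ ℤ} (hK : IsCoord (E.ker x.chC) e ν) (a : E.Lat) {b c : ℝ}
    (hlow : ∀ v : Fin d → ℝ,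
      c * ∑ i, v i ^ 2 ≤ ∑ i, ∑ j, v i * v j * E.gram a.2.2.2 x.chC e i j)
    (hb : ‖E.ev x a‖ ≤ b) (hb' : ∀ i, |slope x a (e i)| ≤ b) (n : H) :
    ‖E.ev x (E.shift n a)‖
      ≤ b * Real.exp (-(c / 2) * ∑ i, (ν i n : ℝ) ^ 2 + b * ∑ i, |(ν i n : ℝ)|) := by
  rw [hx.ev_shift_congr (hK.sub_mem n), norm_ev_shift]
  refine mul_le_mul hb (Real.exp_le_exp.2 ?_) (Real.exp_pos _).le ((norm_nonneg _).trans hb)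
  have h1 := hlow fun i => (ν i n : ℝ)
  have h2 : E.form a.2.2.2 x.chC (∑ i, ν i n • e i) (∑ i, ν i n • e i)
      = ∑ i, ∑ j, (ν i n : ℝ) * (ν j n : ℝ) * E.gram a.2.2.2 x.chC e i j := by
    rw [form_eq_sum (E.pairing_of_mem_ker _) hK]
    simp only [hK.coord_sum]
  have h3 : slope x a (∑ i, ν i n • e i) ≤ b * ∑ i, |(ν i n : ℝ)| := by
    rw [map_sum, Finset.mul_sum]
    refine Finset.sum_le_sum fun i _ => ?_
    rw [map_zsmul, zsmul_eq_mul]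
    refine (le_abs_self _).trans ?_
    rw [abs_mul, mul_comm]
    exact mul_le_mul_of_nonneg_right (hb' i) (abs_nonneg _)
  rw [h2]
  linarith

theorem continuous_slope (k : E.A) (a : E.Lat) (n : H) :
    Continuous fun y : E.Dom k => slope y.1.1 a n := by
  have h1 := (continuous_log_norm_ev (E := E) k (0, 0, E.pairing E.r (a.2.2.2.1 n), 0)).neg
  have h2 := continuous_log_norm_ev (E := E) k (0, a.2.2.2.1 n, E.pairing n a.2.1, 0)
  have h3 := h2.add (h1.div_const 2)
  simp only [ev_trd] at h3
  exact h3

/-- The terms of the trace are bounded by a convergent series, uniformly near a point. -/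
theorem exists_summable_bound [Module.Finite ℤ H] (x : E.Dom k) (a : E.Lat) (ha : a.2.2.2 = k) :
    ∃ u : H ⧸ E.ker x.1.1.chC → ℝ, Summable u ∧ ∀ᶠ y in 𝓝 x, ∀ n,
      ‖E.ev y.1.1 (E.shift (Quotient.out n) a)‖ ≤ u n := by
  obtain ⟨d, e, ν, hK⟩ := exists_isCoord x.2
  obtain ⟨c, hc, hlow⟩ := exists_gram_lower_bound x hK
  obtain ⟨b, hb, hb'⟩ : ∃ b : ℝ, ‖E.ev x.1.1 a‖ < b ∧ ∀ i, |slope x.1.1 a (e i)| < b := by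
    refine ⟨‖E.ev x.1.1 a‖ + ∑ i, |slope x.1.1 a (e i)| + 1, ?_, fun i => ?_⟩
    · have := Finset.sum_nonneg fun i (_ : i ∈ Finset.univ) => abs_nonneg (slope x.1.1 a (e i))
      linarith
    · have := Finset.single_le_sum (f := fun i => |slope x.1.1 a (e i)|)
        (fun i _ => abs_nonneg _) (Finset.mem_univ i)
      have := norm_nonneg (E.ev x.1.1 a)
      linarith
  refine ⟨fun n => b * Real.exp (-(c / 2) * ∑ i, (ν i (Quotient.out n) : ℝ) ^ 2
    + b * ∑ i, |(ν i (Quotient.out n) : ℝ)|), ?_, ?_⟩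
  · have hinj : Function.Injective fun (n : H ⧸ E.ker x.1.1.chC) i => ν i (Quotient.out n) := by
      intro m n hmn
      rw [← QuotientAddGroup.out_eq' m, ← QuotientAddGroup.out_eq' n, QuotientAddGroup.eq,
        ← hK.mem_iff]
      intro i
      have := congrFun hmn i
      simp only at this
      rw [map_add, map_neg, this, neg_add_cancel]
    exact ((Real.summable_exp_neg_sum_sq_add_abs (half_pos hc) b d).comp_injective hinj).mul_left b
  · have h1 := (continuous_ev k a).norm.continuousAt.eventually (gt_mem_nhds hb)
    have h2 : ∀ᶠ y in 𝓝 x, ∀ i, |slope y.1.1 a (e i)| < b := Filter.eventually_all.2 fun i =>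
      (continuous_slope k a (e i)).abs.continuousAt.eventually (gt_mem_nhds (hb' i))
    filter_upwards [h1, h2, hlow, eventually_ker_eq x] with y hy1 hy2 hy3 hy4 n
    rw [← hy4] at hK
    subst ha
    exact norm_ev_shift_le y.1.2 hK a hy3 hy1.le (fun i => (hy2 i).le) _

theorem F_eq (g : E.Ghat) (x : E.ExtChar) {K : AddSubgroup H} (hK : E.ker x.1.chC = K)
    (hg : g.left.m ∈ K) :
    E.F g x = ∑' n : H ⧸ K, E.ev x.1 (E.shift (Quotient.out n) (E.lat g)) := by
  subst hK
  exact tsum_congr fun n => diagCoeff_of_mem x g hg n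

theorem F_eq_zero (g : E.Ghat) (x : E.ExtChar) (hg : g.left.m ∉ E.ker x.1.chC) : E.F g x = 0 := by
  simp only [F, diagCoeff_of_notMem x g hg, tsum_zero]

theorem summable_ev_shift [Module.Finite ℤ H] (x : E.ExtChar) (a : E.Lat)
    (ha : a.2.2.2 ∈ E.Apos x.1.chC) :
    Summable fun n : H ⧸ E.ker x.1.chC => E.ev x.1 (E.shift (Quotient.out n) a) := by
  obtain ⟨u, hu, h⟩ := exists_summable_bound (⟨x, ha⟩ : E.Dom a.2.2.2) a rfl
  exact Summable.of_norm_bounded hu h.self_of_nhds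

theorem traceExists [Module.Finite ℤ H] (x : E.ExtChar) {g : E.Ghat} (hg : g ∈ E.GhatPos x) :
    E.TraceExists x g := by
  by_cases h : g.left.m ∈ E.ker x.1.chC
  · exact (summable_ev_shift x (E.lat g) hg).congr fun n => (diagCoeff_of_mem x g h n).symm
  · exact summable_zero.congr fun n => (diagCoeff_of_notMem x g h n).symm

end ExtHeis

namespace ExtHeis

variable {H H' C : Type*} [AddCommGroup H] [AddCommGroup H'] [AddCommGroup C]
variable {E : ExtHeis H H' C}

/-! ### Characters determine representations -/

/-- The shift by h merely reindexes the sum over H/H_χ, so convergence plays no role. -/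
theorem F_eq_of_rel {x y : E.ExtChar} {h : H} (r : E.Rel h x.1 y.1) (g : E.Ghat) :
    E.F g y = E.F g x := by
  have hker : E.ker y.1.chC = E.ker x.1.chC := by rw [r.chC]
  by_cases hg : g.left.m ∈ E.ker x.1.chC
  · rw [F_eq g y hker hg, F_eq g x rfl hg,
      ← (Equiv.addLeft (h : H ⧸ E.ker x.1.chC)).tsum_eq
        fun n => E.ev x.1 (E.shift (Quotient.out n) (E.lat g))]
    refine tsum_congr fun n => ?_
    rw [rel_iff.1 r _ (show (E.shift _ (E.lat g)).1 ∈ _ from hg), shift_shift]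
    refine x.2.ev_shift_congr ?_ _
    rw [← QuotientAddGroup.eq_zero_iff]
    simp
  · rw [F_eq_zero g x hg, F_eq_zero g y (by rwa [hker])]

/-- The lattice of characters of the torus of `G_χ`, for `H_χ` containing `K`. -/
def incl (E : ExtHeis H H' C) (K : AddSubgroup H) : K × H' × C →+ E.Lat where
  toFun a := (a.1, a.2.1, a.2.2, 0)
  map_zero' := rfl
  map_add' a b := by simp

/-- At (a, j k) both traces are series of characters of a times j-th powers, so the summand of x'
with index 0 occurs among those of x. Here a is confined to the intersection of the kernels, where
both traces have the theta form. -/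
theorem exists_ev_shift_eq [Module.Finite ℤ H] {x x' : E.ExtChar}
    (hpos : E.GhatPos x = E.GhatPos x') (hF : ∀ g ∈ E.GhatPos x, E.F g x = E.F g x') {k : E.A}
    (hk : k ∈ E.Apos x.1.chC) :
    ∃ n : H, (∀ m ∈ E.ker x.1.chC, m ∈ E.ker x'.1.chC → ∀ p c,
        E.ev x.1 (E.shift n (m, p, c, 0)) = E.ev x'.1 (m, p, c, 0)) ∧
      E.ev x.1 (E.shift n (0, 0, 0, k)) = E.ev x'.1 (0, 0, 0, k) := by
  have hpos' : ∀ l, l ∈ E.Apos x.1.chC → l ∈ E.Apos x'.1.chC := fun l hl => by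
    have h : E.ghat (0, 0, 0, l) ∈ E.GhatPos x := hl
    rw [hpos] at h
    exact h
  set K := E.ker x.1.chC ⊓ E.ker x'.1.chC
  have hexp : ∀ (x : E.ExtChar) (n : H) (a : K × H' × C) (j : ℕ),
      x.1.toChar.compAddMonoidHom ((E.shift n).comp (E.incl K)) a
        * E.ev x.1 (E.shift n (0, 0, 0, k)) ^ j
      = E.ev x.1 (E.shift n (E.lat (E.ghat (a.1, a.2.1, a.2.2, j • k)))) := by
    intro x n a j
    have e : E.lat (E.ghat (a.1, a.2.1, a.2.2, j • k))
        = E.incl K a + j • ((0, 0, 0, k) : E.Lat) := by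
      refine Prod.ext ?_ (Prod.ext ?_ (Prod.ext ?_ ?_)) <;> simp [incl]
    rw [e, map_add, map_nsmul, ev_add]
    congr 1
    exact (AddChar.map_nsmul_eq_pow x.1.toChar j _).symm
  have hmem : ∀ (a : K × H' × C) (j : ℕ), 1 ≤ j →
      E.ghat ((a.1 : H), a.2.1, a.2.2, j • k) ∈ E.GhatPos x := fun a j hj => nsmul_mem_Apos hk hj
  obtain ⟨i, hi, hi'⟩ := exists_eq_of_tsum_addChar_mul_pow_eq
    (χ := fun n : H ⧸ E.ker x.1.chC =>
      x.1.toChar.compAddMonoidHom ((E.shift n.out).comp (E.incl K)))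
    (v := fun n => E.ev x.1 (E.shift n.out (0, 0, 0, k)))
    (χ' := fun n : H ⧸ E.ker x'.1.chC =>
      x'.1.toChar.compAddMonoidHom ((E.shift n.out).comp (E.incl K)))
    (v' := fun n => E.ev x'.1 (E.shift n.out (0, 0, 0, k)))
    (fun a j hj => by
      simp only [hexp]
      exact summable_ev_shift x _ (hmem a j hj))
    (fun a j hj => by
      simp only [hexp]
      exact summable_ev_shift x' _ (hpos' _ (hmem a j hj)))
    (fun a j hj => by
      simp only [hexp]
      have h := hF _ (hmem a j hj)
      rwa [F_eq _ x rfl a.1.2.1, F_eq _ x' rfl a.1.2.2] at h)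
    0 (ev_ne_zero _ _)
  -- The representative of the zero class need not be 0, but it acts trivially on x'.
  have hout : Quotient.out (0 : H ⧸ E.ker x'.1.chC) ∈ E.ker x'.1.chC := by
    rw [← QuotientAddGroup.eq_zero_iff]
    exact Quotient.out_eq _
  refine ⟨i.out, fun m hm hm' p c => ?_, ?_⟩
  · rw [← x'.2.ev_shift hout]
    exact DFunLike.congr_fun hi ((⟨m, hm, hm'⟩, p, c) : K × H' × C)
  · rw [← x'.2.ev_shift hout]
    exact hi'

theorem exists_rel_of_F_eq [Module.Finite ℤ H] {x x' : E.ExtChar}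
    (hne : (E.Apos x.1.chC).Nonempty)
    (hpos : E.GhatPos x = E.GhatPos x') (hF : ∀ g ∈ E.GhatPos x, E.F g x = E.F g x') :
    ∃ n, E.Rel n x.1 x'.1 := by
  obtain ⟨k, hk⟩ := hne
  obtain ⟨n, hn, hnk⟩ := exists_ev_shift_eq hpos hF hk
  have hC : x'.1.chC = x.1.chC := by
    ext c
    have := hn 0 (E.ker _).zero_mem (E.ker _).zero_mem 0 c
    simpa [shift_apply, half_zero_left] using this.symm
  have hall : ∀ l ∈ E.Apos x.1.chC, E.ev x.1 (E.shift n (0, 0, 0, l)) = E.ev x'.1 (0, 0, 0, l) := by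
    intro l hl
    obtain ⟨n', hn', hnl⟩ := exists_ev_shift_eq hpos hF hl
    rw [← hnl]
    -- n and n' twist χ_H' in the same way, hence differ by an element of H_χ; one n serves all of
    -- A(χ).
    refine x.2.ev_shift_congr (fun p => ?_) _
    have h1 := hn 0 (E.ker _).zero_mem (E.ker _).zero_mem p 0
    rw [← hn' 0 (E.ker _).zero_mem (E.ker _).zero_mem p 0] at h1
    have h2 : E.ev x.1 (0, p, 0, 0) ≠ 0 := ev_ne_zero _ _
    have h3 : x.1.chC (E.pairing n' p) ≠ 0 := by rw [← ev_trd]; exact ev_ne_zero _ _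
    rw [ev_snd] at h2
    simp only [ev, shift_apply, AddChar.map_zero_eq_one, half_zero_left, AddSubgroup.coe_zero,
      AddMonoidHom.zero_apply, add_zero, zero_add, one_mul, mul_one] at h1
    rw [map_sub, AddMonoidHom.sub_apply, sub_eq_add_neg, AddChar.map_add_eq_mul,
      AddChar.map_neg_eq_inv, mul_left_cancel₀ h2 h1]
    exact mul_inv_cancel₀ h3
  refine ⟨n, rel_iff.2 fun a ha => ?_⟩
  -- An arbitrary l ∈ A is the difference of N k + l ∈ A(χ) and N k, and on both the values agree.
  obtain ⟨N, hN⟩ := exists_nsmul_add_mem_Apos hk a.2.2.2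
  have h1 := hall _ (hN N le_rfl)
  have h2 : ((0, 0, 0, N • k + a.2.2.2) : E.Lat)
      = N • ((0, 0, 0, k) : E.Lat) + (0, 0, 0, a.2.2.2) := by
    refine Prod.ext ?_ (Prod.ext ?_ (Prod.ext ?_ ?_)) <;> simp
  have h3 : ∀ (y : E.Torus) (b : E.Lat), E.ev y (N • b) = E.ev y b ^ N :=
    fun y b => AddChar.map_nsmul_eq_pow y.toChar N b
  have h4 : a = (a.1, a.2.1, a.2.2.1, 0) + (0, 0, 0, a.2.2.2) := by
    refine Prod.ext ?_ (Prod.ext ?_ (Prod.ext ?_ ?_)) <;> simp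
  rw [h2, map_add, ev_add, ev_add, map_nsmul, h3, h3, hnk] at h1
  have h5 := mul_left_cancel₀ (pow_ne_zero N (ev_ne_zero _ _)) h1
  rw [h4, map_add, ev_add, ev_add, h5, hn _ ha (by rw [hC]; exact ha)]

theorem equivalent_iff_F_eq [Module.Finite ℤ H] {x x' : E.ExtChar}
    (hne : (E.Apos x.1.chC).Nonempty) : E.Equivalent x x' ↔
      E.GhatPos x = E.GhatPos x' ∧ ∀ g ∈ E.GhatPos x, E.F g x = E.F g x' := by
  rw [equivalent_iff]
  refine ⟨fun ⟨n, r⟩ => ⟨?_, fun g _ => (F_eq_of_rel r g).symm⟩,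
    fun ⟨h1, h2⟩ => exists_rel_of_F_eq hne h1 h2⟩
  rw [GhatPos, GhatPos, r.chC]

theorem mk_eq_mk_iff {k : E.A} {x y : E.Dom k} :
    (Moduli.mk x : E.Moduli k) = Moduli.mk y ↔ ∃ n, E.Rel n x.1.1 y.1.1 := by
  refine (Quotient.eq (r := E.orbitSetoid k)).trans ?_
  exact ⟨fun ⟨t, h, ht, e⟩ => ⟨h, t, ht, e⟩, fun ⟨h, t, ht, e⟩ => ⟨t, h, ht, e⟩⟩

end ExtHeis

namespace ExtHeis

variable {H H' C : Type*} [AddCommGroup H] [AddCommGroup H'] [AddCommGroup C]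
variable {E : ExtHeis H H' C} {k : E.A}

/-! ### Local coordinates on the domain -/

/-- Evaluation at generators of H embeds A into a power of H'. -/
instance finite_A [Module.Finite ℤ H] [Module.Finite ℤ H'] : Module.Finite ℤ E.A := by
  obtain ⟨n, s, hs⟩ := Module.Finite.exists_fin (R := ℤ) (M := H)
  let f : E.A →ₗ[ℤ] (Fin n → H') :=
    (AddMonoidHom.mk' (fun l : E.A => fun i => l.1 (s i)) fun _ _ => rfl).toIntLinearMap
  refine Module.Finite.of_injective f fun l l' h => Subtype.ext (AddMonoidHom.ext fun m => ?_)
  have h1 : (⊤ : Submodule ℤ H) ≤ LinearMap.eqLocus l.1.toIntLinearMap l'.1.toIntLinearMap := by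
    rw [← hs, Submodule.span_le]
    rintro _ ⟨i, rfl⟩
    exact congrFun h i
  exact h1 (Submodule.mem_top (x := m))

/-- The character `a ↦ ∏ u_i ^ n_i (a)`. -/
def monomial {Γ : Type*} [AddCommGroup Γ] {d : ℕ} (n : Fin d → Γ →+ ℤ) (u : Fin d → ℂˣ) :
    AddChar Γ ℂ where
  toFun a := ((∏ i, u i ^ n i a : ℂˣ) : ℂ)
  map_zero_eq_one' := by simp
  map_add_eq_mul' a b := by
    rw [← Units.val_mul, ← Finset.prod_mul_distrib]
    congr 1
    exact Finset.prod_congr rfl fun i _ => by rw [map_add, zpow_add]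

theorem monomial_apply {Γ : Type*} [AddCommGroup Γ] {d : ℕ} (n : Fin d → Γ →+ ℤ) (u : Fin d → ℂˣ)
    (a : Γ) : monomial n u a = ∏ i, (u i : ℂ) ^ n i a := by
  change ((∏ i, u i ^ n i a : ℂˣ) : ℂ) = _
  simp

theorem monomial_of_eq_zero {Γ : Type*} [AddCommGroup Γ] {d : ℕ} {n : Fin d → Γ →+ ℤ}
    (u : Fin d → ℂˣ) {a : Γ} (h : ∀ i, n i a = 0) : monomial n u a = 1 := by
  simp [monomial_apply, h]

theorem monomial_of_dual {Γ : Type*} [AddCommGroup Γ] {d : ℕ} {n : Fin d → Γ →+ ℤ}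
    (u : Fin d → ℂˣ) {γ : Fin d → Γ} (hδ : ∀ i j, n i (γ j) = if i = j then 1 else 0) (j : Fin d) :
    monomial n u (γ j) = u j := by
  rw [monomial_apply, Finset.prod_eq_single j (fun i _ hij => by rw [hδ, if_neg hij, zpow_zero])
    fun h => absurd (Finset.mem_univ j) h, hδ, if_pos rfl, zpow_one]

/-- The stratum of x, cut down by triviality of χ_H on L, lies in the subgroup Z of the torus, and
it is parametrized near x by x times the monomials ∏ (w_i / z_i)^(n_i). Taking L = ⊥ gives
coordinates on the whole stratum; a complement of H_χ gives the slice. -/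
theorem exists_section [Module.Finite ℤ H] [Module.Finite ℤ E.Lat] (x : E.Dom k)
    (L : AddSubgroup H) (hL : ∀ h ∈ L, x.1.1.chH h = 1) :
    ∃ (d : ℕ) (γ : Fin d → E.Lat) (s : (Fin d → ℂ) → E.Dom k),
      s (fun i => E.ev x.1.1 (γ i)) = x ∧
      (∀ᶠ w in 𝓝 (fun i => E.ev x.1.1 (γ i)), (∀ i, E.ev (s w).1.1 (γ i) = w i) ∧
        E.ker (s w).1.1.chC = E.ker x.1.1.chC ∧ (∀ h ∈ L, (s w).1.1.chH h = 1) ∧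
        ∀ a, DifferentiableAt ℂ (fun w => E.ev (s w).1.1 a) w) ∧
      ∀ᶠ y in 𝓝 x, (∀ h ∈ L, y.1.1.chH h = 1) → y = s (fun i => E.ev y.1.1 (γ i)) := by
  classical
  set K := E.ker x.1.1.chC with hKdef
  let Z : Set E.Torus := {y | (∀ m ∈ K, ∀ p, y.chC (E.pairing m p) = 1) ∧
    (∀ l : E.A, ∀ m ∈ K, y.chH' (l.1 m) * y.chC (E.half l m) = 1) ∧ ∀ h ∈ L, y.chH h = 1}
  have hZ : ∀ y : E.Dom k, E.ker y.1.1.chC = K → (∀ h ∈ L, y.1.1.chH h = 1) → y.1.1 ∈ Z :=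
    fun y hy hyL => ⟨fun m hm => by rw [← hy] at hm; exact hm,
      fun l m hm => y.1.2 l m (by rwa [hy]), hyL⟩
  -- The equations of Z say that certain lattice elements take the value 1. These lie in R, so every
  -- character trivial on R satisfies them.
  let R : AddSubgroup E.Lat :=
    { carrier := {a | ∀ y ∈ Z, E.ev y a = 1}
      zero_mem' := fun y _ => y.toChar.map_zero_eq_one
      add_mem' := fun {a b} ha hb y hy => by rw [ev_add, ha y hy, hb y hy, one_mul]
      neg_mem' := fun {a} ha y hy => by
        have h := y.toChar.map_neg_eq_inv a
        rw [Torus.toChar_apply, Torus.toChar_apply, ha y hy, inv_one] at h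
        exact h }
  obtain ⟨d, γ, n, hδ, hnR, T, ε, hε, hTn, hT⟩ := R.exists_local_coordinates
  let z : Fin d → ℂ := fun i => E.ev x.1.1 (γ i)
  have hz : ∀ i, z i ≠ 0 := fun i => ev_ne_zero _ _
  -- The value at 0 is arbitrary: near z no coordinate vanishes.
  let unit : ℂ → ℂˣ := fun w => if h : w = 0 then 1 else Units.mk0 w h
  have hunit : ∀ w : ℂ, w ≠ 0 → (unit w : ℂ) = w := fun w hw => by
    simp only [unit, dif_neg hw, Units.val_mk0]
  let φ : (Fin d → ℂ) → AddChar E.Lat ℂ := fun w =>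
    x.1.1.toChar * monomial n fun i => unit (w i / z i)
  let c : (Fin d → ℂ) → E.Torus := fun w => E.ofChar (φ w)
  have hc : ∀ w a, E.ev (c w) a = E.ev x.1.1 a * monomial n (fun i => unit (w i / z i)) a :=
    fun w a => E.ev_ofChar _ _
  have hcR : ∀ w, ∀ a ∈ R, E.ev (c w) a = 1 := fun w a ha => by
    rw [hc, monomial_of_eq_zero _ fun i => hnR i a ha, mul_one, ha _ (hZ x rfl hL)]
  have hcZ : ∀ w, c w ∈ Z := by
    refine fun w => ⟨fun m hm p => ?_, fun l m hm => ?_, fun h hh => ?_⟩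
    · rw [← ev_trd]
      exact hcR w _ fun y hy => by rw [ev_trd]; exact hy.1 m hm p
    · have h : ∀ y : E.Torus, E.ev y (0, l.1 m, E.half l m, 0)
          = y.chH' (l.1 m) * y.chC (E.half l m) := fun y => by simp [ev]
      rw [← h]
      exact hcR w _ fun y hy => by rw [h]; exact hy.2.1 l m hm
    · rw [← ev_fst]
      exact hcR w _ fun y hy => by rw [ev_fst]; exact hy.2.2 h hh
  have hne : ∀ᶠ w in 𝓝 z, ∀ i, w i ≠ 0 := Filter.eventually_all.2 fun i =>
    (continuous_apply i).continuousAt.eventually_ne (hz i)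
  have hdiff : ∀ᶠ w in 𝓝 z, ∀ a, DifferentiableAt ℂ (fun w => E.ev (c w) a) w := by
    filter_upwards [hne.eventually_nhds] with w hw a
    have h1 : (fun w => E.ev (c w) a)
        =ᶠ[𝓝 w] fun w => E.ev x.1.1 a * ∏ i, (w i / z i) ^ n i a := by
      filter_upwards [hw] with w' hw'
      rw [hc, monomial_apply]
      congr 1
      exact Finset.prod_congr rfl fun i _ => by rw [hunit _ (div_ne_zero (hw' i) (hz i))]
    refine DifferentiableAt.congr_of_eventuallyEq ?_ h1
    refine DifferentiableAt.const_mul (HasFDerivAt.finsetProd fun i _ => DifferentiableAt.hasFDerivAt ?_).differentiableAt _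
    refine DifferentiableAt.zpow ?_ (Or.inl (div_ne_zero (hw.self_of_nhds i) (hz i)))
    fun_prop
  have hcz : c z = x.1.1 := torus_ext fun a => by
    rw [hc, monomial_apply]
    have : ∀ i, (unit (z i / z i) : ℂ) = 1 := fun i => by
      rw [hunit _ (div_ne_zero (hz i) (hz i)), div_self (hz i)]
    simp [this]
  obtain ⟨d', e, ν, hK⟩ := exists_isCoord x.2
  have hgood : ∀ᶠ w in 𝓝 z, E.ker (c w).chC = K ∧ k ∈ E.Apos (c w).chC := by
    obtain ⟨b, hb, hlow⟩ := (gram_posDef x.2 hK).exists_forall_mul_sum_sq_le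
    have : ∀ᶠ w in 𝓝 z, ∀ i j, |E.gram k (c w).chC e i j - E.gram k x.1.1.chC e i j| < b := by
      refine Filter.eventually_all.2 fun i => Filter.eventually_all.2 fun j => ?_
      have h1 : ContinuousAt (fun w => -Real.log ‖E.ev (c w) (0, 0, E.pairing (e i) (k.1 (e j)), 0)‖)
          z := ((hdiff.self_of_nhds _).continuousAt.norm.log
            (norm_ne_zero_iff.2 (ev_ne_zero _ _))).neg
      simp only [ev_trd] at h1
      have h2 := h1.eventually (Metric.ball_mem_nhds _ hb)
      change ∀ᶠ w in 𝓝 z, |E.gram k (c w).chC e i j - E.gram k (c z).chC e i j| < b at h2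
      rwa [hcz] at h2
    filter_upwards [this] with w hw
    exact ker_eq_and_mem_Apos (hcZ w).1 hK hb (hlow _ fun i j => (hw i j).le)
  have hext : ∀ w, E.ker (c w).chC = K → E.Extendable (c w) :=
    fun w hw l m hm => (hcZ w).2.1 l m (by rwa [← hw])
  -- The value x is a dummy outside the neighbourhood where positivity persists.
  let s : (Fin d → ℂ) → E.Dom k := fun w =>
    if h : E.ker (c w).chC = K ∧ k ∈ E.Apos (c w).chC then ⟨⟨c w, hext w h.1⟩, h.2⟩ else x
  have hs : ∀ᶠ w in 𝓝 z, (s w).1.1 = c w := by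
    filter_upwards [hgood] with w hw
    have : s w = ⟨⟨c w, hext w hw.1⟩, hw.2⟩ := dif_pos hw
    rw [this]
  refine ⟨d, γ, s, ?_, ?_, ?_⟩
  · exact Subtype.ext (Subtype.ext (hs.self_of_nhds.trans hcz))
  · filter_upwards [hs.eventually_nhds, hgood, hdiff, hne] with w hw hw1 hw2 hw3
    have hsw := hw.self_of_nhds
    refine ⟨fun i => ?_, by rw [hsw]; exact hw1.1, by rw [hsw]; exact (hcZ w).2.2, fun a => ?_⟩
    · rw [hsw, hc, monomial_of_dual _ hδ, hunit _ (div_ne_zero (hw3 i) (hz i))]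
      exact mul_div_cancel₀ _ (hz i)
    · exact (hw2 a).congr_of_eventuallyEq (hw.mono fun w' hw' => by
        change E.ev (s w').1.1 a = _
        rw [hw'])
  · have hcont : ContinuousAt (fun (y : E.Dom k) i => E.ev y.1.1 (γ i)) x :=
      (continuous_pi fun i => continuous_ev k (γ i)).continuousAt
    have hclose : ∀ᶠ y in 𝓝 x, ∀ τ ∈ T, ‖E.ev y.1.1 τ * (E.ev x.1.1 τ)⁻¹ - 1‖ < ε := by
      refine (Finset.eventually_all T).2 fun τ _ => ?_
      have h1 : ContinuousAt (fun y : E.Dom k => ‖E.ev y.1.1 τ * (E.ev x.1.1 τ)⁻¹ - 1‖) x :=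
        ((((continuous_ev k τ).mul continuous_const).sub continuous_const).norm).continuousAt
      refine h1.eventually (gt_mem_nhds ?_)
      change ‖E.ev x.1.1 τ * (E.ev x.1.1 τ)⁻¹ - 1‖ < ε
      rw [mul_inv_cancel₀ (ev_ne_zero _ _), sub_self, norm_zero]
      exact hε
    filter_upwards [hclose, hcont.eventually hs, eventually_ker_eq x] with y hy1 hy2 hy3 hyL
    refine Subtype.ext (Subtype.ext ?_)
    rw [hy2]
    have hyne : ∀ i, E.ev y.1.1 (γ i) / z i ≠ 0 := fun i => div_ne_zero (ev_ne_zero _ _) (hz i)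
    have hval : ∀ a, (y.1.1.toChar * (φ fun i => E.ev y.1.1 (γ i))⁻¹) a
        = E.ev y.1.1 a * (E.ev (c fun i => E.ev y.1.1 (γ i)) a)⁻¹ := fun a => by
      rw [AddChar.mul_apply, AddChar.inv_apply, AddChar.map_neg_eq_inv, E.ev_ofChar]
      rfl
    -- The quotient of y by the parametrized point is trivial on R and at every γ i, and close to 1
    -- on T, hence trivial.
    have h1 := hT (y.1.1.toChar * (φ fun i => E.ev y.1.1 (γ i))⁻¹)
      (fun a ha => by
        rw [hval, hcR _ a ha, ha _ (hZ y hy3 hyL), inv_one, mul_one])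
      (fun i => by
        rw [hval, hc, monomial_of_dual _ hδ, hunit _ (hyne i)]
        have h4 : E.ev x.1.1 (γ i) * (E.ev y.1.1 (γ i) / z i) = E.ev y.1.1 (γ i) :=
          mul_div_cancel₀ _ (hz i)
        rw [h4, mul_inv_cancel₀ (ev_ne_zero _ _)])
      (fun τ hτ => by
        rw [hval, hc, monomial_of_eq_zero _ (hTn τ hτ), mul_one]
        exact hy1 τ hτ)
    refine torus_ext fun a => ?_
    have h2 := DFunLike.congr_fun h1 a
    rw [hval, AddChar.one_apply] at h2
    exact eq_of_div_eq_one ((div_eq_mul_inv _ _).trans h2)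

/-- A map to the domain along which the characters are differentiable is continuous. -/
theorem continuousAt_of_section {V : Type*} [NormedAddCommGroup V] [NormedSpace ℂ V]
    {s : V → E.Dom k} {w : V} (h1 : ∀ a, DifferentiableAt ℂ (fun w => E.ev (s w).1.1 a) w)
    (h2 : ∀ᶠ w' in 𝓝 w, E.ker (s w').1.1.chC = E.ker (s w).1.1.chC) : ContinuousAt s w :=
  tendsto_dom (fun a => (h1 a).continuousAt) h2

theorem domHolAt_F [Module.Finite ℤ H] [Module.Finite ℤ E.Lat] {g : E.Ghat} (hg : E.rot g = k)
    (x : E.Dom k) : E.DomHolAt (fun y => E.F g y.1) x := by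
  have hbot : ∀ y : E.Dom k, ∀ h ∈ (⊥ : AddSubgroup H), y.1.1.chH h = 1 := by
    rintro y _ rfl
    exact AddChar.map_zero_eq_one _
  obtain ⟨d, γ, s, hsx, hs, hx⟩ := exists_section x ⊥ (hbot x)
  refine ⟨d, γ, fun w => E.F g (s w).1, ?_, ?_⟩
  · by_cases hm : g.left.m ∈ E.ker x.1.1.chC
    · obtain ⟨u, hu, hbound⟩ := exists_summable_bound x (E.lat g) hg
      have hcont : ContinuousAt s (fun i => E.ev x.1.1 (γ i)) :=
        continuousAt_of_section hs.self_of_nhds.2.2.2 (hs.mono fun w hw => by rw [hw.2.1, hsx])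
      rw [ContinuousAt, hsx] at hcont
      -- Continuity of the section carries the uniform bound from the domain to the coordinate
      -- space.
      have h1 := eventually_differentiableAt_tsum hu (z₀ := fun i => E.ev x.1.1 (γ i))
        (f := fun n w => E.ev (s w).1.1 (E.shift (Quotient.out n) (E.lat g))) (by
          filter_upwards [hs, hcont.eventually hbound]
            with w hw hw' n
          exact ⟨hw.2.2.2 _, hw' n⟩)
      filter_upwards [h1, hs.eventually_nhds] with w hw1 hw2
      exact hw1.congr_of_eventuallyEq (hw2.mono fun w' hw' => F_eq g _ hw'.2.1 hm)
    · filter_upwards [hs.eventually_nhds] with w hw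
      refine (differentiableAt_const (0 : ℂ)).congr_of_eventuallyEq (hw.mono fun w' hw' => ?_)
      exact F_eq_zero g _ (by rwa [hw'.2.1])
  · filter_upwards [hx] with y hy
    rw [← hy (hbot y)]

end ExtHeis

namespace ExtHeis

variable {H H' C : Type*} [AddCommGroup H] [AddCommGroup H'] [AddCommGroup C]
variable {E : ExtHeis H H' C} {k : E.A}

/-! ### The quotient map -/

/-- The action of the group elements on the domain. -/
def actDom (t : AddChar H ℂ) (h : H) (y : E.Dom k) : E.Dom k :=
  ⟨⟨E.act t h y.1.1, y.1.2.act t h⟩, y.2⟩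

theorem continuous_actDom (t : AddChar H ℂ) (h : H) :
    Continuous (actDom t h : E.Dom k → E.Dom k) := by
  refine continuous_iff_continuousAt.2 fun y => tendsto_dom (fun a => ?_) ?_
  · have : (fun y : E.Dom k => E.ev (actDom t h y).1.1 a)
        = fun y => t a.1 * E.ev y.1.1 (E.shift h a) := funext fun y => E.ev_act t h _ a
    have h2 : Continuous fun y : E.Dom k => E.ev (actDom t h y).1.1 a := by
      rw [this]
      exact continuous_const.mul (continuous_ev k _)
    exact h2.continuousAt
  · exact eventually_ker_eq y

/-- The pair (t, n) taking y into the open set acts continuously. The condition on t depends on H_χ,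
so it is a legitimate group element only on the stratum of y, which is open. -/
theorem isOpenMap_mk : IsOpenMap (Moduli.mk : E.Dom k → E.Moduli k) := by
  intro U hU
  change IsOpen ((Moduli.mk : E.Dom k → E.Moduli k) ⁻¹' (Moduli.mk '' U))
  refine isOpen_iff_mem_nhds.2 ?_
  rintro y ⟨x, hx, hxy⟩
  obtain ⟨n, t, ht, e⟩ := mk_eq_mk_iff.1 hxy.symm
  have e' : actDom t n y = x := Subtype.ext (Subtype.ext e.symm)
  have h1 := (continuous_actDom (E := E) (k := k) t n).continuousAt.eventually
    (hU.mem_nhds (e' ▸ hx))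
  filter_upwards [h1, eventually_ker_eq y] with y' hy' hker
  exact ⟨_, hy', (mk_eq_mk_iff.2 ⟨n, t, by rwa [hker], rfl⟩).symm⟩

theorem isOpenQuotientMap_mk : IsOpenQuotientMap (Moduli.mk : E.Dom k → E.Moduli k) :=
  ⟨Quotient.mk_surjective, continuous_quot_mk, isOpenMap_mk⟩

theorem secondCountable_dom [Module.Finite ℤ H] [Module.Finite ℤ E.Lat] :
    SecondCountableTopology (E.Dom k) := by
  have : Countable E.Lat := Finsupp.Countable.of_moduleFinite (R := ℤ)
  let _ : TopologicalSpace (AddSubgroup H) := ⊥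
  have : DiscreteTopology (AddSubgroup H) := ⟨rfl⟩
  have h := TopologicalSpace.secondCountableTopology_iInf (α := E.Dom k) (ι := Bool)
    (t := fun b => cond b (TopologicalSpace.induced (fun x : E.Dom k => E.ev x.1.1) inferInstance)
      (TopologicalSpace.induced (fun x : E.Dom k => E.ker x.1.1.chC) ⊥)) (by
    rintro (_ | _)
    · exact TopologicalSpace.secondCountableTopology_induced _ (AddSubgroup H) _
    · exact TopologicalSpace.secondCountableTopology_induced _ (E.Lat → ℂ) _)
  rw [iInf_bool_eq] at h
  exact h

theorem secondCountable_moduli [Module.Finite ℤ H] [Module.Finite ℤ E.Lat] :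
    SecondCountableTopology (E.Moduli k) := by
  have := secondCountable_dom (E := E) (k := k)
  exact isOpenQuotientMap_mk.isQuotientMap.secondCountableTopology isOpenMap_mk

/-! ### Proper discontinuity -/

/-- Near two points of the domain only finitely many elements of `H / H_χ` matter. -/
theorem exists_finset_rel [Module.Finite ℤ H] (x y : E.Dom k) :
    ∃ S : Finset H, ∀ᶠ p in 𝓝 x ×ˢ 𝓝 y, ∀ h, E.Rel h p.1.1.1 p.2.1.1 →
      ∃ h' ∈ S, E.Rel h' p.1.1.1 p.2.1.1 ∧ h - h' ∈ E.ker x.1.1.chC := by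
  classical
  obtain ⟨d, e, ν, hK⟩ := exists_isCoord x.2
  obtain ⟨c, hc, hlow⟩ := exists_gram_lower_bound x hK
  -- Acting by h translates f by the Gram matrix applied to the coordinates ν of h. Near x and y
  -- this translation is bounded by b in each entry, while the matrix is at least c, so ν is
  -- bounded.
  let f : E.Dom k → Fin d → ℝ := fun y i => negLog y.1.1.chH' (k.1 (e i))
  have hf : ∀ i, Continuous fun y => f y i := fun i => by
    have := (continuous_log_norm_ev (E := E) k (0, k.1 (e i), 0, 0)).neg
    refine this.congr fun y => ?_
    change -Real.log ‖E.ev y.1.1 _‖ = _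
    rw [ev_snd]
    rfl
  set b := ∑ i, |f x i - f y i| + 1 with hb
  have hbi : ∀ i, |f x i - f y i| < b := fun i => by
    have := Finset.single_le_sum (f := fun i => |f x i - f y i|)
      (fun i _ => abs_nonneg _) (Finset.mem_univ i)
    linarith
  have hb0 : 0 ≤ b := by
    have := Finset.sum_nonneg fun i (_ : i ∈ Finset.univ) => abs_nonneg (f x i - f y i)
    linarith
  -- From c ∑ ν_i² ≤ b ∑ |ν_i| ≤ d b² / (2c) + (c / 2) ∑ ν_i² follows ∑ ν_i² ≤ d b² / c².
  obtain ⟨N, hN⟩ := exists_nat_ge (d * (b ^ 2 / c ^ 2))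
  refine ⟨(Fintype.piFinset fun _ : Fin d => Finset.Icc (-(N : ℤ)) N).image
    fun a => ∑ i, a i • e i, ?_⟩
  have hnear : ∀ᶠ p in 𝓝 x ×ˢ 𝓝 y, ∀ i, |f p.1 i - f p.2 i| < b := by
    refine Filter.eventually_all.2 fun i => ?_
    have h1 : Filter.Tendsto (fun p : E.Dom k × E.Dom k => |f p.1 i - f p.2 i|) (𝓝 x ×ˢ 𝓝 y)
        (𝓝 |f x i - f y i|) :=
      ((((hf i).tendsto x).comp Filter.tendsto_fst).sub
        (((hf i).tendsto y).comp Filter.tendsto_snd)).abs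
    exact h1.eventually (gt_mem_nhds (hbi i))
  have hfst : Filter.Tendsto Prod.fst (𝓝 x ×ˢ 𝓝 y) (𝓝 x) := Filter.tendsto_fst
  filter_upwards [hnear, hfst.eventually hlow, hfst.eventually (eventually_ker_eq x)]
    with p hp1 hp2 hp3 h r
  have hmem := hK.sub_mem h
  have r' := r.congr p.1.1.2 (h' := ∑ i, ν i h • e i) (by rw [hp3]; exact hmem)
  refine ⟨_, Finset.mem_image_of_mem _ ?_, r', hmem⟩
  have hpair : ∀ m ∈ E.ker x.1.1.chC, ∀ q, p.1.1.1.chC (E.pairing m q) = 1 := by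
    rw [← hp3]
    exact E.pairing_of_mem_ker _
  have hform : ∀ i, E.form k p.1.1.1.chC (∑ i, ν i h • e i) (e i) = f p.2 i - f p.1 i := by
    intro i
    have h1 := rel_iff.1 r' (0, k.1 (e i), 0, 0) (AddSubgroup.zero_mem _)
    have h2 : E.ev p.1.1.1 (E.shift (∑ i, ν i h • e i) (0, k.1 (e i), 0, 0))
        = p.1.1.1.chH' (k.1 (e i)) * p.1.1.1.chC (E.pairing (∑ i, ν i h • e i) (k.1 (e i))) := by
      simp [ev, shift_apply, half_zero_left]
    rw [h2, ev_snd] at h1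
    simp only [f, form, negLog_apply, h1, norm_mul]
    rw [Real.log_mul]
    · ring
    · rw [← ev_snd]; exact norm_ne_zero_iff.2 (ev_ne_zero _ _)
    · rw [← ev_trd]; exact norm_ne_zero_iff.2 (ev_ne_zero _ _)
  have hle := hp2 fun i => (ν i h : ℝ)
  have hq : ∑ i, ∑ j, (ν i h : ℝ) * (ν j h : ℝ) * E.gram k p.1.1.1.chC e i j
      = ∑ i, (ν i h : ℝ) * (f p.2 i - f p.1 i) := by
    have h1 := form_eq_sum (k := k) hpair hK (∑ i, ν i h • e i) (∑ i, ν i h • e i)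
    simp only [hK.coord_sum] at h1
    rw [← h1, form_sum_right]
    exact Finset.sum_congr rfl fun i _ => by rw [hform]
  have hsum : ∑ i, (ν i h : ℝ) * (f p.2 i - f p.1 i)
      ≤ ∑ i, (b ^ 2 / (2 * c) + c / 2 * (ν i h : ℝ) ^ 2) := by
    refine Finset.sum_le_sum fun i _ => ?_
    have h1 : (ν i h : ℝ) * (f p.2 i - f p.1 i) ≤ |(ν i h : ℝ)| * b := by
      refine (le_abs_self _).trans ?_
      rw [abs_mul, abs_sub_comm]
      exact mul_le_mul_of_nonneg_left (hp1 i).le (abs_nonneg _)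
    have h2 := sq_nonneg (c * |(ν i h : ℝ)| - b)
    have h3 : b ^ 2 / (2 * c) + c / 2 * (ν i h : ℝ) ^ 2 - |(ν i h : ℝ)| * b
        = (c * |(ν i h : ℝ)| - b) ^ 2 / (2 * c) := by
      rw [← sq_abs (ν i h : ℝ)]
      field_simp
      ring
    have h4 : 0 ≤ (c * |(ν i h : ℝ)| - b) ^ 2 / (2 * c) := by positivity
    linarith
  rw [Finset.sum_add_distrib, ← Finset.mul_sum, Finset.sum_const, Finset.card_univ,
    Fintype.card_fin, nsmul_eq_mul] at hsum
  have htot : ∑ i, (ν i h : ℝ) ^ 2 ≤ N := by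
    refine le_trans ?_ hN
    have h1 : c / 2 * ∑ i, (ν i h : ℝ) ^ 2 ≤ d * (b ^ 2 / (2 * c)) := by linarith
    have h2 : d * (b ^ 2 / c ^ 2) = d * (b ^ 2 / (2 * c)) / (c / 2) := by
      field_simp
    rw [h2, le_div_iff₀ (half_pos hc)]
    linarith
  refine Fintype.mem_piFinset.2 fun i => Finset.mem_Icc.2 ?_
  have h1 := (Finset.single_le_sum (f := fun i => (ν i h : ℝ) ^ 2) (fun i _ => sq_nonneg _)
    (Finset.mem_univ i)).trans htot
  have h2 : (ν i h) ^ 2 ≤ (N : ℤ) := by exact_mod_cast h1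
  rw [← abs_le]
  refine le_trans ?_ h2
  exact (Int.le_self_sq _).trans_eq (sq_abs _)

/-- Failure of the relation is witnessed by unequal values at a single lattice element, which is an
open condition on the strata. -/
theorem eventually_not_rel {x y : E.Dom k} {h : H} (hn : ¬ E.Rel h x.1.1 y.1.1) :
    ∀ᶠ p in 𝓝 x ×ˢ 𝓝 y, ¬ E.Rel h p.1.1.1 p.2.1.1 := by
  rw [rel_iff] at hn
  push Not at hn
  obtain ⟨a, ha, hne⟩ := hn
  have h1 : Filter.Tendsto (fun p : E.Dom k × E.Dom k => E.ev p.2.1.1 a) (𝓝 x ×ˢ 𝓝 y)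
      (𝓝 (E.ev y.1.1 a)) := ((continuous_ev k a).tendsto y).comp Filter.tendsto_snd
  have h2 : Filter.Tendsto (fun p : E.Dom k × E.Dom k => E.ev p.1.1.1 (E.shift h a)) (𝓝 x ×ˢ 𝓝 y)
      (𝓝 (E.ev x.1.1 (E.shift h a))) :=
    ((continuous_ev k (E.shift h a)).tendsto x).comp Filter.tendsto_fst
  have hfst : Filter.Tendsto Prod.fst (𝓝 x ×ˢ 𝓝 y) (𝓝 x) := Filter.tendsto_fst
  filter_upwards [(h1.prodMk_nhds h2).eventually ((isOpen_ne_fun continuous_fst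
    continuous_snd).mem_nhds hne), hfst.eventually (eventually_ker_eq x)] with p hp hker r
  exact hp (rel_iff.1 r a (by rwa [hker]))

/-- For an open quotient map it suffices that the relation is closed. Near an inequivalent pair only
finitely many h can matter, and each is excluded on a neighbourhood. -/
theorem t2_moduli [Module.Finite ℤ H] : T2Space (E.Moduli k) := by
  rw [t2Space_iff_of_isOpenQuotientMap isOpenQuotientMap_mk, ← isOpen_compl_iff]
  refine isOpen_iff_mem_nhds.2 ?_
  rintro ⟨x, y⟩ hxy
  have hxy : ¬ ∃ n, E.Rel n x.1.1 y.1.1 := fun h => hxy (mk_eq_mk_iff.2 h)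
  rw [nhds_prod_eq]
  obtain ⟨S, hS⟩ := exists_finset_rel x y
  have h1 : ∀ᶠ p in 𝓝 x ×ˢ 𝓝 y, ∀ h ∈ S, ¬ E.Rel h p.1.1.1 p.2.1.1 :=
    (Finset.eventually_all S).2 fun h _ => eventually_not_rel fun r => hxy ⟨h, r⟩
  filter_upwards [hS, h1] with p hp1 hp2 hp3
  obtain ⟨n, r⟩ := mk_eq_mk_iff.1 hp3
  obtain ⟨h', hh', r', -⟩ := hp1 n r
  exact hp2 h' hh' r'

/-- H/H_χ acts freely: h multiplies the value at k h ∈ H' by χ_C⟨h, k h⟩, which has modulus less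
than 1. -/
theorem not_rel_self {x : E.Dom k} {h : H} (hh : h ∉ E.ker x.1.1.chC) :
    ¬ E.Rel h x.1.1 x.1.1 := by
  intro r
  have h1 := rel_iff.1 r (0, k.1 h, 0, 0) (AddSubgroup.zero_mem _)
  have h2 : E.ev x.1.1 (E.shift h (0, k.1 h, 0, 0))
      = E.ev x.1.1 (0, k.1 h, 0, 0) * x.1.1.chC (E.pairing h (k.1 h)) := by
    simp [ev, shift_apply, half_zero_left]
  rw [h2] at h1
  have h3 : x.1.1.chC (E.pairing h (k.1 h)) = 1 :=
    mul_left_cancel₀ (ev_ne_zero x.1.1 (0, k.1 h, 0, 0)) (by rw [← h1, mul_one])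
  have h4 := x.2.1 h hh
  rw [h3] at h4
  simp at h4

/-- Equivalent points close to each other have the same characters of `G_χ` and `A`. -/
theorem eventually_ev_eq_of_mk_eq [Module.Finite ℤ H] (x : E.Dom k) :
    ∀ᶠ p in 𝓝 x ×ˢ 𝓝 x, (Moduli.mk p.1 : E.Moduli k) = Moduli.mk p.2 →
      ∀ a : E.Lat, a.1 ∈ E.ker x.1.1.chC → E.ev p.2.1.1 a = E.ev p.1.1.1 a := by
  obtain ⟨S, hS⟩ := exists_finset_rel x x
  have h1 : ∀ᶠ p in 𝓝 x ×ˢ 𝓝 x, ∀ h ∈ S, h ∉ E.ker x.1.1.chC → ¬ E.Rel h p.1.1.1 p.2.1.1 := by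
    refine (Finset.eventually_all S).2 fun h _ => ?_
    by_cases hh : h ∈ E.ker x.1.1.chC
    · exact Filter.Eventually.of_forall fun p hp => absurd hh hp
    · exact (eventually_not_rel (not_rel_self hh)).mono fun p hp _ => hp
  have hfst : Filter.Tendsto Prod.fst (𝓝 x ×ˢ 𝓝 x) (𝓝 x) := Filter.tendsto_fst
  filter_upwards [hS, h1, hfst.eventually (eventually_ker_eq x)] with p hp1 hp2 hker hp3 a ha
  obtain ⟨n, r⟩ := mk_eq_mk_iff.1 hp3
  obtain ⟨h', hh', r', -⟩ := hp1 n r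
  have hmem : h' ∈ E.ker p.1.1.1.chC := by
    rw [hker]
    by_contra hcon
    exact hp2 h' hh' hcon r'
  rw [rel_iff.1 r' a (by rwa [hker]), p.1.1.2.ev_shift hmem]

/-! ### Slices and charts -/

/-- H splits as H_χ plus the span of the e_i. The group T_{H/H_χ} adjusts χ_H freely on that span,
so each orbit meets the locus where χ_H is trivial there, and the section through this locus is the
slice. -/
theorem exists_slice [Module.Finite ℤ H] [Module.Finite ℤ E.Lat] (q : E.Moduli k) :
    ∃ (x : E.Dom k) (d : ℕ) (γ : Fin d → E.Lat) (s : (Fin d → ℂ) → E.Dom k),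
      Moduli.mk x = q ∧ (∀ i, (γ i).1 ∈ E.ker x.1.1.chC) ∧
      s (fun i => E.ev x.1.1 (γ i)) = x ∧
      (∀ᶠ w in 𝓝 (fun i => E.ev x.1.1 (γ i)), (∀ i, E.ev (s w).1.1 (γ i) = w i) ∧
        E.ker (s w).1.1.chC = E.ker x.1.1.chC ∧
        ∀ a, DifferentiableAt ℂ (fun w => E.ev (s w).1.1 a) w) ∧
      ∀ᶠ y in 𝓝 x, Moduli.mk y = (Moduli.mk (s fun i => E.ev y.1.1 (γ i)) : E.Moduli k) := by
  obtain ⟨x₁, rfl⟩ := Quotient.mk_surjective q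
  obtain ⟨d', e, ν, hK⟩ := exists_isCoord x₁.2
  let ρ : H →+ H := AddMonoidHom.mk' (fun h => ∑ i, ν i h • e i) fun h h' => by
    simp only [map_add, add_smul, Finset.sum_add_distrib]
  have hρ : ∀ h, ρ h = ∑ i, ν i h • e i := fun h => rfl
  have hρK : ∀ h, h - ρ h ∈ E.ker x₁.1.1.chC := fun h => by rw [hρ]; exact hK.sub_mem h
  have hρ0 : ∀ h ∈ E.ker x₁.1.1.chC, ρ h = 0 := fun h hh => by
    rw [hρ]
    exact Finset.sum_eq_zero fun i _ => by rw [(hK.mem_iff h).2 hh i, zero_smul]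
  let π : H →+ H := AddMonoidHom.id H - ρ
  have hπ : ∀ h, π h = h - ρ h := fun h => rfl
  have hππ : ∀ h, ρ (π h) = 0 := fun h => hρ0 _ (hρK h)
  -- ρ projects onto the span of the e_i and π onto H_χ; `nrm` makes χ_H trivial on that span.
  let nrm : E.Dom k → E.Dom k := fun y => actDom (y.1.1.chH⁻¹.compAddMonoidHom ρ) 0 y
  -- Coordinates of the form P(γ) have first component in H_χ and so do not see T_{H/H_χ}; on the
  -- slice they equal the original ones.
  let P : E.Lat → E.Lat := fun a => (π a.1, a.2)
  have hnrm : ∀ (y : E.Dom k) (a : E.Lat), E.ev (nrm y).1.1 a = E.ev y.1.1 (P a) := by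
    intro y a
    have h1 : a = P a + (ρ a.1, 0) := Prod.ext (by simp [P, hπ]) (by simp [P])
    have h2 : y.1.1.chH (-(ρ a.1)) * y.1.1.chH (ρ a.1) = 1 := by
      rw [← AddChar.map_add_eq_mul]; simp
    refine (E.ev_act _ _ _ _).trans ?_
    rw [shift_zero]
    conv_lhs => rw [h1]
    rw [ev_add, show ((ρ a.1, 0) : E.Lat) = (ρ a.1, 0, 0, 0) from rfl, ev_fst]
    change y.1.1.chH (-(ρ (P a + (ρ a.1, 0)).1)) * _ = _
    rw [← h1]
    linear_combination E.ev y.1.1 (P a) * h2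
  have hrel : ∀ y : E.Dom k, E.ker y.1.1.chC = E.ker x₁.1.1.chC →
      (Moduli.mk (nrm y) : E.Moduli k) = Moduli.mk y := by
    intro y hy
    refine (mk_eq_mk_iff.2 ⟨0, _, fun m hm => ?_, rfl⟩).symm
    rw [hy] at hm
    change y.1.1.chH (-(ρ m)) = 1
    rw [hρ0 m hm, neg_zero, AddChar.map_zero_eq_one]
  let L : AddSubgroup H := π.ker
  have hLn : ∀ y : E.Dom k, ∀ h ∈ L, (nrm y).1.1.chH h = 1 := by
    intro y h hh
    rw [← ev_fst, hnrm]
    change E.ev y.1.1 (π h, 0) = 1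
    rw [show π h = 0 from hh]
    exact y.1.1.toChar.map_zero_eq_one
  have hPL : ∀ y : E.Dom k, (∀ h ∈ L, y.1.1.chH h = 1) → ∀ a, E.ev y.1.1 (P a) = E.ev y.1.1 a := by
    intro y hy a
    have h1 : a = P a + (ρ a.1, 0) := Prod.ext (by simp [P, hπ]) (by simp [P])
    have h2 : ρ a.1 ∈ L := by
      change π (ρ a.1) = 0
      have := hππ a.1
      rw [hπ, map_sub] at this
      rw [hπ]
      exact this
    conv_rhs => rw [h1]
    rw [ev_add, show ((ρ a.1, 0) : E.Lat) = (ρ a.1, 0, 0, 0) from rfl, ev_fst, hy _ h2, mul_one]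
  set x := nrm x₁ with hx
  have hxK : E.ker x.1.1.chC = E.ker x₁.1.1.chC := rfl
  obtain ⟨d, γ, s, hsx, hs, hnear⟩ := exists_section x L (hLn x₁)
  have hev : ∀ i, E.ev x.1.1 (P (γ i)) = E.ev x.1.1 (γ i) := fun i => hPL x (hLn x₁) _
  refine ⟨x, d, fun i => P (γ i), s, hrel x₁ rfl, fun i => hρK _, ?_, ?_, ?_⟩
  · simp only [hev]
    exact hsx
  · simp only [hev]
    filter_upwards [hs] with w hw
    exact ⟨fun i => by rw [hPL _ hw.2.2.1, hw.1], hw.2.1, hw.2.2.2⟩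
  · have hcont : Filter.Tendsto nrm (𝓝 x) (𝓝 x) := by
      refine tendsto_dom (fun a => ?_) (eventually_ker_eq x)
      simp only [hnrm]
      have := (continuous_ev k (P a)).tendsto x
      rwa [hPL x (hLn x₁)] at this
    filter_upwards [hcont.eventually hnear, eventually_ker_eq x] with y hy hyK
    rw [← hrel y hyK, hy (hLn y)]
    simp only [hnrm]

end ExtHeis

/-! ### The complex structure of the quotient -/

namespace ExtHeis

variable {H H' C : Type*} [AddCommGroup H] [AddCommGroup H'] [AddCommGroup C]
variable {E : ExtHeis H H' C} {k : E.A}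

/-- Holomorphy upstairs restricts to the slice by composition with s. Conversely a function of the
slice coordinates pulls back to every point above, because the group element carrying that point to
the slice turns the coordinates γ i into other lattice elements. -/
theorem moduliHolAt_iff {d : ℕ} {γ : Fin d → E.Lat} {s : (Fin d → ℂ) → E.Dom k}
    {K : AddSubgroup H} (hγ : ∀ i, (γ i).1 ∈ K) {w : Fin d → ℂ}
    (hs : ∀ᶠ w' in 𝓝 w, (∀ i, E.ev (s w').1.1 (γ i) = w' i) ∧ E.ker (s w').1.1.chC = K ∧
      ∀ a, DifferentiableAt ℂ (fun w => E.ev (s w).1.1 a) w')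
    (hnear : ∀ᶠ y in 𝓝 (s w),
      Moduli.mk y = (Moduli.mk (s fun i => E.ev y.1.1 (γ i)) : E.Moduli k))
    (f : E.Moduli k → ℂ) : E.ModuliHolAt f (Moduli.mk (s w)) ↔
      ∀ᶠ z in 𝓝 w, DifferentiableAt ℂ (fun w => f (Moduli.mk (s w))) z := by
  have hw := hs.self_of_nhds
  constructor
  · intro hf
    obtain ⟨N, β, Φ, hΦ, hfΦ⟩ := hf _ rfl
    have hcont : ContinuousAt s w :=
      continuousAt_of_section hw.2.2 (hs.mono fun w' hw' => by rw [hw'.2.1, hw.2.1])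
    have hG : ∀ w', (∀ a, DifferentiableAt ℂ (fun w => E.ev (s w).1.1 a) w') →
        DifferentiableAt ℂ (fun w i => E.ev (s w).1.1 (β i)) w' :=
      fun w' h => differentiableAt_pi.2 fun i => h (β i)
    filter_upwards [hs, (hcont.eventually hfΦ).eventually_nhds,
      (hG w hw.2.2).continuousAt.eventually hΦ] with w' h1 h2 h3
    exact (h3.comp w' (hG w' h1.2.2)).congr_of_eventuallyEq h2
  · intro hf y hy
    obtain ⟨h, t, ht, e⟩ := mk_eq_mk_iff.1 hy
    have r : E.Rel h y.1.1 (s w).1.1 := ⟨t, ht, e⟩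
    have hyK : E.ker y.1.1.chC = K := by rw [← hw.2.1, r.chC]
    have hty : actDom t h y = s w := Subtype.ext (Subtype.ext e.symm)
    -- Since γ i has first component in H_χ, the part t of the group element does not affect these
    -- values.
    refine ⟨d, fun i => E.shift h (γ i), fun z => f (Moduli.mk (s z)), ?_, ?_⟩
    · have h1 : (fun i => E.ev y.1.1 (E.shift h (γ i))) = w := funext fun i => by
        rw [← rel_iff.1 r (γ i) (by rw [hyK]; exact hγ i), hw.1]
      rw [h1]
      exact hf
    · have hcont := (continuous_actDom (E := E) (k := k) t h).tendsto y
      rw [hty] at hcont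
      filter_upwards [hcont.eventually hnear, eventually_ker_eq y] with y' h1 h2
      have r' : E.Rel h y'.1.1 (actDom t h y').1.1 := ⟨t, by rwa [h2], rfl⟩
      have h3 : (fun i => E.ev (actDom t h y').1.1 (γ i))
          = fun i => E.ev y'.1.1 (E.shift h (γ i)) := funext fun i =>
        rel_iff.1 r' (γ i) (by rw [h2, hyK]; exact hγ i)
      rw [h3] at h1
      change f (Moduli.mk y') = _
      rw [mk_eq_mk_iff.2 ⟨h, r'⟩, h1]

/-- The class of s(w) is injective in w near z, since equivalent nearby points share their values at
the γ i, and these values are w. It is open because every y near s(w) is equivalent to the slice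
point with the same coordinates. -/
theorem exists_chart [Module.Finite ℤ H] [Module.Finite ℤ E.Lat] (q : E.Moduli k) :
    ∃ (d : ℕ) (e : OpenPartialHomeomorph (E.Moduli k) (Fin d → ℂ)), q ∈ e.source ∧
      ∀ y ∈ e.source, ∀ f : E.Moduli k → ℂ, E.ModuliHolAt f y ↔
        ∀ᶠ z in 𝓝 (e y), DifferentiableAt ℂ (fun w => f (e.symm w)) z := by
  obtain ⟨x, d, γ, s, hxq, hγ, hsx, hs, hnear⟩ := exists_slice q
  set z : Fin d → ℂ := fun i => E.ev x.1.1 (γ i) with hz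
  have hcontz : Filter.Tendsto s (𝓝 z) (𝓝 x) := by
    have h := continuousAt_of_section hs.self_of_nhds.2.2
      (hs.mono fun w hw => by rw [hw.2.1, hsx])
    rwa [ContinuousAt, hsx] at h
  obtain ⟨A, hA, B, hB, hAB⟩ := Filter.eventually_prod_iff.1 (eventually_ev_eq_of_mk_eq x)
  obtain ⟨W, hWsub, hWo, hzW⟩ := eventually_nhds_iff.1 (hs.and ((hcontz.eventually
    hnear.eventually_nhds).and ((hcontz.eventually hA).and (hcontz.eventually hB))))
  have hWnhds : ∀ w ∈ W, W ∈ 𝓝 w := fun w hw => hWo.mem_nhds hw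
  have hsW : ∀ w ∈ W, ∀ᶠ w' in 𝓝 w, (∀ i, E.ev (s w').1.1 (γ i) = w' i) ∧
      E.ker (s w').1.1.chC = E.ker x.1.1.chC ∧
      ∀ a, DifferentiableAt ℂ (fun w => E.ev (s w).1.1 a) w' :=
    fun w hw => Filter.mem_of_superset (hWnhds w hw) fun w' hw' => (hWsub w' hw').1
  let F : (Fin d → ℂ) → E.Moduli k := fun w => Moduli.mk (s w)
  have hinj : Set.InjOn F W := by
    intro w hw w' hw' he
    have h1 := hAB (hWsub w hw).2.2.1 (hWsub w' hw').2.2.2 he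
    ext i
    rw [← (hWsub w hw).1.1 i, ← (hWsub w' hw').1.1 i]
    exact (h1 (γ i) (hγ i)).symm
  have hcont : ∀ w ∈ W, ContinuousAt s w := fun w hw =>
    continuousAt_of_section (hWsub w hw).1.2.2
      ((hsW w hw).mono fun w' hw' => by rw [hw'.2.1, (hWsub w hw).1.2.1])
  let e₀ := (hinj.bijOn_image).toPartialEquiv F W (F '' W)
  have hsrc : e₀.source = W := rfl
  have hopen : IsOpenMap (e₀.source.domRestrict e₀) := by
    refine IsOpenMap.of_nhds_le ?_
    rintro ⟨w, hw⟩ U hU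
    rw [Filter.mem_map, nhds_subtype, Filter.mem_comap] at hU
    obtain ⟨V, hV, hVU⟩ := hU
    have hco : ContinuousAt (fun (y : E.Dom k) i => E.ev y.1.1 (γ i)) (s w) :=
      (continuous_pi fun i => continuous_ev k (γ i)).continuousAt
    have hval : (fun i => E.ev (s w).1.1 (γ i)) = w := funext (hWsub w hw).1.1
    rw [ContinuousAt, hval] at hco
    change U ∈ 𝓝 (Moduli.mk (s w))
    rw [← isOpenQuotientMap_mk.map_nhds_eq, Filter.mem_map]
    filter_upwards [(hWsub w hw).2.1, hco.eventually hV, hco.eventually (hWnhds w hw)]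
      with y hy hyV hyW
    change Moduli.mk y ∈ U
    rw [hy]
    exact @hVU ⟨_, hyW⟩ hyV
  let e := OpenPartialHomeomorph.ofContinuousOpenRestrict e₀
    (fun w hw => (isOpenQuotientMap_mk.continuous.continuousAt.comp
      (hcont w hw)).continuousWithinAt) hopen hWo
  -- e is the parametrization by the slice; the chart is its inverse.
  refine ⟨d, e.symm, ?_, ?_⟩
  · refine ⟨z, hzW, ?_⟩
    change Moduli.mk (s z) = q
    rw [hsx, hxq]
  · rintro _ ⟨w, hw, rfl⟩ f
    have h1 : e.symm (F w) = w := e.left_inv hw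
    rw [h1]
    exact moduliHolAt_iff hγ (hsW w hw) (hWsub w hw).2.1 f

end ExtHeis

/-! ### The main theorem -/

theorem mainTheorem4 {H H' C : Type*} [AddCommGroup H] [AddCommGroup H'] [AddCommGroup C]
    [AddGroup.FG H] [AddGroup.FG H'] [AddGroup.FG C] (E : ExtHeis H H' C) :
    -- the traces exist on `Ĝ (χ)`
    (∀ (x : E.ExtChar), ∀ g ∈ E.GhatPos x, E.TraceExists x g) ∧
    -- characters determine representations
    (∀ x x' : E.ExtChar, (E.Apos x.1.chC).Nonempty →
      (E.Equivalent x x' ↔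
        E.GhatPos x = E.GhatPos x' ∧ ∀ g ∈ E.GhatPos x, E.F g x = E.F g x')) ∧
    -- the quotients are complex-analytic manifolds on which the characters are holomorphic
    -- functions, and their points are the equivalence classes of the representations
    (∀ k : E.A,
      IsComplexManifold (E.Moduli k) E.ModuliHolAt ∧
      (∀ g : E.Ghat, E.rot g = k → ∃ Fbar : E.Moduli k → ℂ,
        (∀ q, E.ModuliHolAt Fbar q) ∧ ∀ x : E.Dom k, Fbar (ExtHeis.Moduli.mk x) = E.F g x.1) ∧
      (∀ x y : E.Dom k,
        (ExtHeis.Moduli.mk x : E.Moduli k) = ExtHeis.Moduli.mk y ↔ E.Equivalent x.1 y.1)) := by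
  have : Module.Finite ℤ H := Module.Finite.iff_addGroup_fg.2 ‹_›
  have : Module.Finite ℤ H' := Module.Finite.iff_addGroup_fg.2 ‹_›
  have : Module.Finite ℤ C := Module.Finite.iff_addGroup_fg.2 ‹_›
  refine ⟨fun x g hg => ExtHeis.traceExists x hg,
    fun x x' hne => ExtHeis.equivalent_iff_F_eq hne, fun k => ⟨⟨?_, ?_, ?_⟩, fun g hg => ?_, ?_⟩⟩
  · exact ExtHeis.t2_moduli
  · exact ExtHeis.secondCountable_moduli
  · exact ExtHeis.exists_chart
  · refine ⟨Quotient.lift (fun x : E.Dom k => E.F g x.1) ?_, fun q x _ => ?_, fun x => rfl⟩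
    · rintro x y ⟨t, h, ht, e⟩
      exact (ExtHeis.F_eq_of_rel (h := h) ⟨t, ht, e⟩ g).symm
    · exact ExtHeis.domHolAt_F hg x
  · exact fun x y => ExtHeis.mk_eq_mk_iff.trans ExtHeis.equivalent_iff.symm
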